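/- Let $N\ge 1$ and $m\ge 2$ be integers, let $n>0$ be real, and let $\Omega\subset\mathbb R^N$ be a bounded open set. Put $\psi(v)=|v|^{-\frac n{n+1}}v$, and let $\tilde D^m=\Delta^{m/2}$ if $m$ is even and $\tilde D^m=\nabla\Delta^{(m-1)/2}$ if $m$ is odd. For $u\in H^m_0(\Omega)$ (the closure of $C_c^\infty(\Omega)$ in $W^{m,2}(\Omega)$) let $$\Phi[u]=\frac12\int_\Omega|u|^{\frac{n+2}{n+1}}\,dx,\qquad E[u]=-\int_\Omega|\tilde D^m u|^2\,dx+\int_\Omega u^2\,dx ,$$ and define $\Phi[u]$ by the same formula for all $u\in L^2(\Omega)$. Let $v_0\in H^m_0(\Omega)$ and $0<S\le\infty$, and let $v$ be a weak solution on $\Omega\times[0,S)$ of the Dirichlet problem $$\frac{\partial}{\partial t}\psi(v)=(-1)^{m+1}\Delta^m v+v\ \text{ in }\Omega,\qquad v=Dv=\dots=D^{m-1}v=0\ \text{ on }\partial\Omega,\qquad v(0)=v_0 .$$ This means that $v\in C([0,S);L^2(\Omega))\cap L^2_{\rm loc}([0,S);H^m_0(\Omega))$, that $v(0)=v_0$,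 and that for all $\varphi\in C_c^\infty(\Omega)$ and all $t\in[0,S)$ $$\int_\Omega\psi(v(t))\varphi\,dx-\int_\Omega\psi(v_0)\varphi\,dx=\int_0^t\Big(-\int_\Omega\tilde D^m v(s)\cdot\tilde D^m\varphi\,dx+\int_\Omega v(s)\varphi\,dx\Big)ds .$$ Write $\Phi(t)=\Phi[v(t)]$ and $E(0)=E[v_0]$, and suppose that $\Phi(0)>0$ and $E(0)>0$. Then $\Phi$ has a right derivative $\Phi'(0)>0$ at $t=0$, and with $$T:=\frac{n+2}{n}\,\frac{\Phi(0)}{\Phi'(0)}=\frac2n\,\frac{\Phi(0)}{E(0)}\in(0,\infty)$$ we have $$\Phi(t)\ \ge\ \Phi(0)\,\frac1{(1-t/T)^{\frac{n+2}n}}\qquad\text{for all }t\in[0,S),$$ and $S\le T$. That is, the solution blows up in finite time: it cannot exist beyond the time $T$, and if it exists on all of $[0,T)$, then $\Phi(t)\to\infty$ as $t\to T^-$. -/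

import Mathlib

open MeasureTheory Set Filter Topology TopologicalSpace
open scoped ENNReal Distributions

noncomputable section

namespace PolyharmonicBlowUp

/-- `ℝ^N` with its Euclidean structure. -/
abbrev Space (N : ℕ) : Type := EuclideanSpace ℝ (Fin N)

/-- The values of `D̃^m`: one slot (`none`) for the scalar `Δ^{m/2}` (`m` even) and `N` slots
(`some i`) for the vector `∇ Δ^{(m-1)/2}` (`m` odd). The slots that `m` does not use hold `0`. -/
abbrev TildeSpace (N : ℕ) : Type := EuclideanSpace ℝ (Option (Fin N))

/-- The real Hilbert space `L²(Ω)`. -/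
abbrev L2 {N : ℕ} (Ω : Opens (Space N)) : Type :=
  Lp ℝ 2 (volume.restrict (Ω : Set (Space N)))

/-- The Hilbert space of square integrable fields on `Ω` with values in `TildeSpace N`. -/
abbrev L2Tilde {N : ℕ} (Ω : Opens (Space N)) : Type :=
  Lp (TildeSpace N) 2 (volume.restrict (Ω : Set (Space N)))

/-- `Δ^k f` for a smooth function `f`. -/
def lapPow {N : ℕ} (k : ℕ) (f : Space N → ℝ) : Space N → ℝ :=
  (fun g : Space N → ℝ => (Laplacian.laplacian g : Space N → ℝ))^[k] f

/-- The components of `D̃^m f` for a smooth function `f`, where `D̃^m f = Δ^{m/2} f` for even `m`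
and `D̃^m f = ∇ Δ^{(m-1)/2} f` for odd `m`. -/
def tildeDComp {N : ℕ} (m : ℕ) (f : Space N → ℝ) : Option (Fin N) → Space N → ℝ
  | none => fun x => if Even m then lapPow (m / 2) f x else 0
  | some i => fun x =>
      if Even m then 0 else fderiv ℝ (lapPow (m / 2) f) x (EuclideanSpace.single i 1)

/-- `D̃^m f` for a smooth function `f`. -/
def tildeD {N : ℕ} (m : ℕ) (f : Space N → ℝ) (x : Space N) : TildeSpace N :=
  WithLp.toLp 2 (fun i => tildeDComp m f i x)

/-- `g = D̃^m u` on `Ω` in the weak sense. -/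
def HasWeakTildeD {N : ℕ} (m : ℕ) {Ω : Opens (Space N)} (u : L2 Ω) (g : L2Tilde Ω) : Prop :=
  ∀ (φ : 𝓓(Ω, ℝ)) (i : Option (Fin N)),
    ∫ x in (Ω : Set (Space N)), u x * tildeDComp m φ i x =
      (-1) ^ m * ∫ x in (Ω : Set (Space N)), g x i * φ x

open Classical in
/-- The weak `D̃^m u ∈ L²(Ω)` of `u ∈ L²(Ω)`. It is unique when it exists; the value is `0` when
there is none, which does not happen for `u ∈ H^m_0(Ω)`. -/
def weakTildeD {N : ℕ} (m : ℕ) {Ω : Opens (Space N)} (u : L2 Ω) : L2Tilde Ω :=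
  if h : ∃ g : L2Tilde Ω, HasWeakTildeD m u g then h.choose else 0

/-- `u ∈ H^m_0(Ω) = W^{m,2}_0(Ω)`, the closure of `C_c^∞(Ω)` in `W^{m,2}(Ω)`: some test functions
converge to `u` in `L²(Ω)` and their derivatives of every order `j ≤ m` converge in `L²(Ω)`. -/
def MemH0 {N : ℕ} (m : ℕ) {Ω : Opens (Space N)} (u : L2 Ω) : Prop :=
  ∃ φ : ℕ → 𝓓(Ω, ℝ),
    Tendsto (fun k => eLpNorm (fun x => φ k x - u x) 2
      (volume.restrict (Ω : Set (Space N)))) atTop (𝓝 0) ∧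
    ∀ j ≤ m, ∃ g : Space N → ContinuousMultilinearMap ℝ (fun _ : Fin j => Space N) ℝ,
      MemLp g 2 (volume.restrict (Ω : Set (Space N))) ∧
      Tendsto (fun k => eLpNorm (fun x => iteratedFDeriv ℝ j (φ k) x - g x) 2
        (volume.restrict (Ω : Set (Space N)))) atTop (𝓝 0)

/-- `ψ(v) = |v|^{-n/(n+1)} v`. -/
def psi (n : ℝ) (v : ℝ) : ℝ := |v| ^ (-(n / (n + 1))) * v

/-- `Φ = ½ ∫_Ω |u|^{(n+2)/(n+1)} dx`. -/
def PhiFun {N : ℕ} (n : ℝ) {Ω : Opens (Space N)} (u : L2 Ω) : ℝ :=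
  (1 / 2) * ∫ x in (Ω : Set (Space N)), |u x| ^ ((n + 2) / (n + 1))

/-- `∫_Ω |D̃^m u|² dx`. -/
def dirichletInt {N : ℕ} (m : ℕ) {Ω : Opens (Space N)} (u : L2 Ω) : ℝ :=
  ∫ x in (Ω : Set (Space N)), ‖weakTildeD m u x‖ ^ 2

/-- `E = -∫_Ω |D̃^m u|² dx + ∫_Ω u² dx`. -/
def energy {N : ℕ} (m : ℕ) {Ω : Opens (Space N)} (u : L2 Ω) : ℝ :=
  -dirichletInt m u + ∫ x in (Ω : Set (Space N)), (u x) ^ 2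

/-- `v` is a weak solution on `Ω × [0, S)`, `0 < S ≤ ∞`, of
`∂_t ψ(v) = (-1)^{m+1} Δ^m v + v` in `Ω`, with `v = Dv = … = D^{m-1}v = 0` on `∂Ω` and
`v(0) = v₀`, in the class `C([0,S); L²(Ω)) ∩ L²_loc([0,S); H^m_0(Ω))`. -/
structure IsWeakSolution {N : ℕ} (m : ℕ) (n : ℝ) {Ω : Opens (Space N)} (S : EReal)
    (v₀ : L2 Ω) (v : ℝ → L2 Ω) : Prop where
  continuousOn : ContinuousOn v {t : ℝ | 0 ≤ t ∧ (t : EReal) < S}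
  initial : v 0 = v₀
  memH0 : ∀ᵐ t : ℝ, 0 < t → (t : EReal) < S → MemH0 m (v t)
  sqIntegrable : ∀ τ : ℝ, 0 < τ → (τ : EReal) < S →
    IntegrableOn (fun t => dirichletInt m (v t)) (Ioo 0 τ)
  weakForm : ∀ (φ : 𝓓(Ω, ℝ)) (t : ℝ), 0 ≤ t → (t : EReal) < S →
    (∫ x in (Ω : Set (Space N)), psi n (v t x) * φ x) -
        ∫ x in (Ω : Set (Space N)), psi n (v₀ x) * φ x =
      ∫ s in (0 : ℝ)..t,
        (-(∫ x in (Ω : Set (Space N)), inner ℝ (weakTildeD m (v s) x) (tildeD m φ x)) +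
          ∫ x in (Ω : Set (Space N)), v s x * φ x)

end PolyharmonicBlowUp

end

/-! Set `F = (n+2)⁻¹ ∫ |u|^p` with `p = (n+2)/(n+1)`, so that `Φ = (n+2)/2 · F`. The equation is
formally a gradient flow: `ψ(v)_t` is half the gradient of `E`. Hence `F' = ⟨ψ(v)_t, v⟩ = E` and `E'
= 2 ∫ ψ'(v) v_t²`. Since `ψ'(v) v² = |v|^p / (n+1)`, Cauchy–Schwarz gives `E² = (∫ ψ'(v) v v_t)² ≤ p
F · E' / 2`. With `q = 2/p > 1` this reads `(log E)' ≥ q (log F)'`, so `F' = E ≥ E(0) (F/F(0))^q`,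
and `F^{1-q}` falls at least linearly with slope `-(q-1) E(0) F(0)^{-q}`. As `1 - q = -n/(n+2)`,
this is the stated rate, and the line reaches zero at `T`.

A weak solution has no `v_t`, and `v(t)` is known to lie in `H^m_0` only for almost every `t`. The
argument is therefore run in an abstract Hilbert setting (`IsGradientFlow`) on the window integrals
`∫_s^{s+δ} g` of the lift `g` of `v` to the energy space. Their energy has derivative `2 ⟨ψ(v(s+δ))
- ψ(v(s)), v(s+δ) - v(s)⟩`, which is nonnegative by monotonicity. A discrete Cauchy–Schwarz
inequality (`psi_coercive`) bounds it below; dividing by `δ²` and letting `δ → 0` gives the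
integrated form of `E' ≥ 2E²/(pF)` (`energy_growth`).

The delicate point is the initial time: the averages `t⁻¹ ∫_0^t g` must converge to `v₀` in the
energy norm (`tendsto_average`). Monotonicity between times `0` and `s` bounds them, which gives
weak convergence, and also bounds their limiting norm, which makes the convergence strong. Then `E ≥
E(0)` almost everywhere, so `g` is essentially bounded, `F(v)` is Lipschitz, and convexity yields
`F' = E` (`ae_hasDerivAt_F`). -/

set_option linter.unusedSectionVars false

noncomputable section

namespace PolyharmonicBlowUp

/-! ### Absolutely continuous functions of one variable -/

section AbsolutelyContinuous

variable {X Y : Type*} [PseudoMetricSpace X] [PseudoMetricSpace Y]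

/-- Domination of increments by those of an absolutely continuous function. -/
lemma absolutelyContinuousOnInterval_of_dist_le {f : ℝ → X} {h : ℝ → Y} {a b : ℝ} (C : ℝ)
    (hh : AbsolutelyContinuousOnInterval h a b)
    (H : ∀ s ∈ uIcc a b, ∀ t ∈ uIcc a b, dist (f s) (f t) ≤ C * dist (h s) (h t)) :
    AbsolutelyContinuousOnInterval f a b := by
  rw [absolutelyContinuousOnInterval_iff] at hh ⊢
  intro ε hε
  obtain ⟨δ, hδ, h⟩ := hh (ε / (|C| + 1)) (by positivity)
  refine ⟨δ, hδ, fun E hE hEδ => ?_⟩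
  have h1 := h E hE hEδ
  rw [lt_div_iff₀ (by positivity), mul_comm] at h1
  refine lt_of_le_of_lt ?_ h1
  rw [Finset.mul_sum]
  refine Finset.sum_le_sum fun i hi => (H _ (hE.1 i hi).1 _ (hE.1 i hi).2).trans ?_
  have := le_abs_self C
  gcongr
  linarith

lemma integral_eq_sub_of_ae_hasDerivAt {f f' : ℝ → ℝ} {a b : ℝ} (hab : a ≤ b)
    (hf : AbsolutelyContinuousOnInterval f a b)
    (h : ∀ᵐ t, t ∈ Ioo a b → HasDerivAt f (f' t) t) :
    ∫ t in a..b, f' t = f b - f a := by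
  rw [← hf.integral_deriv_eq_sub]
  apply intervalIntegral.integral_congr_ae
  have hb : ∀ᵐ x : ℝ, x ≠ b := by simp [ae_iff, measure_singleton]
  filter_upwards [h, hb] with t ht htb hmem
  rw [uIoc_of_le hab] at hmem
  exact (ht ⟨hmem.1, lt_of_le_of_ne hmem.2 htb⟩).deriv.symm

lemma intervalIntegrable_of_ae_hasDerivAt {f f' : ℝ → ℝ} {a b : ℝ} (hab : a ≤ b)
    (hf : AbsolutelyContinuousOnInterval f a b)
    (h : ∀ᵐ t, t ∈ Ioo a b → HasDerivAt f (f' t) t) :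
    IntervalIntegrable f' volume a b := by
  refine hf.intervalIntegrable_deriv.congr_ae ?_
  have hb : ∀ᵐ x : ℝ, x ≠ b := by simp [ae_iff, measure_singleton]
  rw [uIoc_of_le hab, Filter.EventuallyEq, ae_restrict_iff' measurableSet_Ioc]
  filter_upwards [h, hb] with t ht htb hmem
  exact (ht ⟨hmem.1, lt_of_le_of_ne hmem.2 htb⟩).deriv

lemma le_of_ae_hasDerivAt_nonneg {f f' : ℝ → ℝ} {a b : ℝ} (hab : a ≤ b)
    (hf : AbsolutelyContinuousOnInterval f a b)
    (h : ∀ᵐ t, t ∈ Ioo a b → HasDerivAt f (f' t) t ∧ 0 ≤ f' t) : f a ≤ f b := by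
  have h1 := integral_eq_sub_of_ae_hasDerivAt hab hf (h.mono fun t ht hm => (ht hm).1)
  have h2 : 0 ≤ ∫ t in a..b, f' t := by
    apply intervalIntegral.integral_nonneg_of_ae_restrict hab
    have hb : ∀ᵐ x : ℝ, x ≠ b := by simp [ae_iff, measure_singleton]
    have ha : ∀ᵐ x : ℝ, x ≠ a := by simp [ae_iff, measure_singleton]
    rw [Filter.EventuallyLE, ae_restrict_iff' measurableSet_Icc]
    filter_upwards [h, hb, ha] with t ht htb hta hmem
    exact (ht ⟨lt_of_le_of_ne hmem.1 (Ne.symm hta), lt_of_le_of_ne hmem.2 htb⟩).2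
  linarith

/-- Absolute continuity of a smooth function of an absolutely continuous function. -/
lemma absolutelyContinuousOnInterval_comp_contDiffOn {f φ : ℝ → ℝ} {a b : ℝ} {l : ℝ}
    (hf : AbsolutelyContinuousOnInterval f a b) (hl : ∀ t ∈ uIcc a b, l ≤ f t)
    (hφ : ContDiffOn ℝ 1 φ (Ici l)) :
    AbsolutelyContinuousOnInterval (fun t => φ (f t)) a b := by
  obtain ⟨M, hM⟩ := hf.exists_bound
  have hsub : ∀ t ∈ uIcc a b, f t ∈ Icc l (max l M) := fun t ht =>
    ⟨hl t ht, le_max_of_le_right ((le_abs_self _).trans (hM t ht))⟩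
  obtain ⟨K, hK⟩ := (hφ.mono (t := Icc l (max l M)) Icc_subset_Ici_self).exists_lipschitzOnWith
    one_ne_zero (convex_Icc _ _) isCompact_Icc
  exact absolutelyContinuousOnInterval_of_dist_le K hf fun s hs t ht =>
    hK.dist_le_mul _ (hsub s hs) _ (hsub t ht)

end AbsolutelyContinuous

/-! ### Chain rule for a quadratic form along a primitive -/

section Bilinear

variable {G : Type*} [NormedAddCommGroup G] [NormedSpace ℝ G] [CompleteSpace G]

/-- The chain rule `B(W,W)' = 2 B(W,W')` in integrated form, for a primitive `W`. -/
lemma bilin_self_sub_eq_integral (B : G →L[ℝ] G →L[ℝ] ℝ) (hB : ∀ x y, B x y = B y x)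
    {w W : ℝ → G} (hw : Integrable w) (hW : ∀ s t, W t - W s = ∫ r in s..t, w r)
    {a b : ℝ} (hab : a ≤ b) :
    B (W b) (W b) - B (W a) (W a) = 2 * ∫ s in a..b, B (W s) (w s) := by
  have hWeq : W = fun t => W a + ∫ r in a..t, w r := by
    funext t; rw [← hW a t]; abel
  have hder : ∀ᵐ t, HasDerivAt W (w t) t := by
    filter_upwards [LocallyIntegrable.ae_hasDerivAt_integral hw.locallyIntegrable] with t ht
    rw [hWeq]
    simpa using (ht a).const_add (W a)
  have hWc : Continuous W := by
    rw [hWeq]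
    exact continuous_const.add (intervalIntegral.continuous_primitive
      (fun _ _ => hw.intervalIntegrable) a)
  obtain ⟨M, hM⟩ := (isCompact_uIcc (a := a) (b := b)).exists_bound_of_continuousOn
    hWc.continuousOn
  have hM0 : 0 ≤ M := (norm_nonneg _).trans (hM a left_mem_uIcc)
  have hAC : AbsolutelyContinuousOnInterval (fun t => B (W t) (W t)) a b := by
    -- Increments of `W` are dominated by those of the primitive of `‖w‖`; each of the two slots of
    -- `B` contributes a factor `‖B‖ * M`.
    refine absolutelyContinuousOnInterval_of_dist_le (2 * ‖B‖ * M)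
      ((hw.norm.intervalIntegrable (a := a)
        (b := b)).absolutelyContinuousOnInterval_intervalIntegral (left_mem_uIcc)) ?_
    intro s hs t ht
    have h1 : B (W s) (W s) - B (W t) (W t) = B (W s - W t) (W s) + B (W t) (W s - W t) := by
      simp only [map_sub, _root_.sub_apply]; ring
    have h2 : ‖W s - W t‖ ≤ |∫ r in t..s, ‖w r‖| := by
      rw [hW]; exact intervalIntegral.norm_integral_le_abs_integral_norm
    have h3 : dist (∫ v in a..s, ‖w v‖) (∫ v in a..t, ‖w v‖) = |∫ r in t..s, ‖w r‖| := by
      rw [Real.dist_eq, intervalIntegral.integral_interval_sub_left] <;>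
        exact hw.norm.intervalIntegrable
    rw [h3, Real.dist_eq, h1]
    have h4 := B.le_opNorm₂ (W s - W t) (W s)
    have h5 := B.le_opNorm₂ (W t) (W s - W t)
    rw [Real.norm_eq_abs] at h4 h5
    have h6 : ‖B‖ * ‖W s - W t‖ * ‖W s‖ ≤ ‖B‖ * |∫ r in t..s, ‖w r‖| * M := by
      gcongr; exact hM s hs
    have h7 : ‖B‖ * ‖W t‖ * ‖W s - W t‖ ≤ ‖B‖ * M * |∫ r in t..s, ‖w r‖| := by
      gcongr; exact hM t ht
    refine (abs_add_le _ _).trans ?_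
    linarith
  rw [← integral_eq_sub_of_ae_hasDerivAt hab hAC (f' := fun t => 2 * B (W t) (w t)),
    intervalIntegral.integral_const_mul]
  filter_upwards [hder] with t ht _
  refine (B.hasFDerivAt_of_bilinear ht.hasFDerivAt ht.hasFDerivAt).hasDerivAt.congr_deriv ?_
  simp [hB (w t) (W t), two_mul]

end Bilinear

/-! ### The differential inequality -/

section ODE

/-- The differential inequality behind the blow-up: `f' = e ≥ G`, `G' = 2 e² / (p f)` force
`f^{1-q}`, `q = 2/p`, to decrease at least linearly. -/
lemma rpow_le_of_energy_growth {p q a f₀ e₀ : ℝ} {f G e : ℝ → ℝ} (hp : 0 < p) (hq : q = 2 / p)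
    (hq1 : 1 < q) (ha : 0 ≤ a) (hf₀ : 0 < f₀) (he₀ : 0 < e₀)
    (hf : AbsolutelyContinuousOnInterval f 0 a) (hG : AbsolutelyContinuousOnInterval G 0 a)
    (hf0 : f 0 = f₀) (hG0 : G 0 = e₀)
    (hfpos : ∀ t ∈ Icc 0 a, f₀ ≤ f t) (hGpos : ∀ t ∈ Icc 0 a, e₀ ≤ G t)
    (hf' : ∀ᵐ t, t ∈ Ioo 0 a → HasDerivAt f (e t) t)
    (hG' : ∀ᵐ t, t ∈ Ioo 0 a → HasDerivAt G (2 * e t ^ 2 / (p * f t)) t)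
    (hGe : ∀ᵐ t, t ∈ Ioo 0 a → G t ≤ e t) :
    f a ^ (1 - q) ≤ f₀ ^ (1 - q) - (q - 1) * e₀ * f₀ ^ (-q) * a := by
  have hu : uIcc 0 a = Icc 0 a := uIcc_of_le ha
  have hlog : ∀ l : ℝ, 0 < l → ContDiffOn ℝ 1 Real.log (Ici l) := fun l hl =>
    Real.contDiffOn_log.mono fun x hx => (hl.trans_le hx).ne'
  -- The function `log G - q log f` is nondecreasing: its derivative equals `q (e/f) (e - G)/G`.
  have key : ∀ t ∈ Icc 0 a, e₀ * (f t / f₀) ^ q ≤ G t := by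
    intro t ht
    have hft := hf₀.trans_le (hfpos t ht)
    have hGt := he₀.trans_le (hGpos t ht)
    have hsub : uIcc 0 t ⊆ uIcc 0 a := by
      rw [hu, uIcc_of_le ht.1]; exact Icc_subset_Icc_right ht.2
    have hAC := ((absolutelyContinuousOnInterval_comp_contDiffOn hG (l := e₀) (by rwa [hu]) (hlog e₀ he₀)).sub
      ((absolutelyContinuousOnInterval_comp_contDiffOn hf (l := f₀) (by rwa [hu]) (hlog f₀ hf₀)).const_mul q)).mono hsub
    have := le_of_ae_hasDerivAt_nonneg
      (f' := fun s => 2 * e s ^ 2 / (p * f s) / G s - q * (e s / f s)) ht.1 hAC ?_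
    · simp only [Pi.sub_apply, hf0, hG0] at this
      have h1 : Real.log (e₀ * (f t / f₀) ^ q) ≤ Real.log (G t) := by
        rw [Real.log_mul he₀.ne' (by positivity), Real.log_rpow (by positivity),
          Real.log_div hft.ne' hf₀.ne']
        linarith
      exact (Real.log_le_log_iff (by positivity) hGt).1 h1
    · filter_upwards [hf', hG', hGe] with s h1 h2 h3 hs
      have hs' : s ∈ Ioo 0 a := ⟨hs.1, hs.2.trans_le ht.2⟩
      have hsc : s ∈ Icc 0 a := ⟨hs'.1.le, hs'.2.le⟩
      have hfs := hf₀.trans_le (hfpos s hsc)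
      have hGs := he₀.trans_le (hGpos s hsc)
      refine ⟨((h2 hs').log hGs.ne').sub (((h1 hs').log hfs.ne').const_mul q), ?_⟩
      have hes : 0 ≤ e s := hGs.le.trans (h3 hs')
      have : 2 * e s ^ 2 / (p * f s) / G s - q * (e s / f s)
          = q * (e s / f s) * ((e s - G s) / G s) := by
        rw [hq]; field_simp
      rw [this]
      have := sub_nonneg.2 (h3 hs')
      positivity
  have hpow : ContDiffOn ℝ 1 (fun x : ℝ => x ^ (1 - q)) (Ici f₀) := fun x hx =>
    (Real.contDiffAt_rpow_const_of_ne (hf₀.trans_le hx).ne').contDiffWithinAt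
  have hlin : AbsolutelyContinuousOnInterval (fun t : ℝ => t) 0 a :=
    (contDiff_id.contDiffOn (n := 1)).absolutelyContinuousOnInterval
  have hAC := ((absolutelyContinuousOnInterval_comp_contDiffOn hf (by rwa [hu]) hpow).add
    (hlin.const_mul ((q - 1) * e₀ * f₀ ^ (-q)))).neg
  have := le_of_ae_hasDerivAt_nonneg
    (f' := fun s => -(e s * (1 - q) * f s ^ (1 - q - 1) + (q - 1) * e₀ * f₀ ^ (-q) * 1)) ha hAC ?_
  · simp only [Pi.neg_apply, Pi.add_apply, hf0] at this
    linarith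
  · filter_upwards [hf', hGe] with s h1 h3 hs
    have hsc : s ∈ Icc 0 a := ⟨hs.1.le, hs.2.le⟩
    have hfs := hf₀.trans_le (hfpos s hsc)
    refine ⟨(((h1 hs).rpow_const (Or.inl hfs.ne')).add
      ((hasDerivAt_id s).const_mul _)).neg, ?_⟩
    have h4 := (key s hsc).trans (h3 hs)
    rw [Real.div_rpow hfs.le hf₀.le] at h4
    -- This is `e ≥ G ≥ e₀ (f/f₀)^q`, rearranged to bound the derivative of `f^{1-q}`, which is
    -- `-(q-1) e f^{-q}`.
    have h5 : e₀ * f₀ ^ (-q) ≤ e s * f s ^ (-q) := by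
      rw [Real.rpow_neg hf₀.le, Real.rpow_neg hfs.le]
      have := Real.rpow_pos_of_pos hfs q
      have := Real.rpow_pos_of_pos hf₀ q
      rw [← div_eq_mul_inv, ← div_eq_mul_inv, div_le_div_iff₀ (by positivity) (by positivity)]
      rw [mul_div_assoc', div_le_iff₀ (by positivity)] at h4
      exact h4
    have h6 : (1 : ℝ) - q - 1 = -q := by ring
    rw [h6]
    nlinarith
end ODE

/-- The exceptional set in the open interval is open and null, hence empty; the endpoints follow by
closure. -/
lemma le_on_Icc_of_ae_le {f k : ℝ → ℝ} {a b : ℝ} (hab : a < b) (hf : Continuous f)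
    (hk : Continuous k) (h : ∀ᵐ s, s ∈ Ioo a b → f s ≤ k s) : ∀ s ∈ Icc a b, f s ≤ k s := by
  have hopen : IsOpen (Ioo a b ∩ {s | k s < f s}) := isOpen_Ioo.inter (isOpen_lt hk hf)
  have hempty : Ioo a b ∩ {s | k s < f s} = ∅ := by
    refine hopen.eq_empty_of_measure_zero (μ := volume) ?_
    rw [measure_eq_zero_iff_ae_notMem]
    filter_upwards [h] with s hs hm
    exact absurd (hs hm.1) (not_le.2 hm.2)
  have hsub : Ioo a b ⊆ {s | f s ≤ k s} := fun s hs => by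
    by_contra hcon
    have : s ∈ Ioo a b ∩ {s | k s < f s} := ⟨hs, by simpa using hcon⟩
    rw [hempty] at this
    exact this
  have := closure_minimal hsub (isClosed_le hf hk)
  rwa [closure_Ioo hab.ne] at this

/-! ### Abstract doubly nonlinear gradient flows -/

section AbstractFlow

variable {G H K : Type*} [NormedAddCommGroup G] [InnerProductSpace ℝ G] [CompleteSpace G]
  [NormedAddCommGroup H] [InnerProductSpace ℝ H] [CompleteSpace H]
  [NormedAddCommGroup K] [InnerProductSpace ℝ K] [CompleteSpace K]

/-- The quadratic form `⟪J x, J y⟫ - ⟪D x, D y⟫`. -/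
def energyForm (J : G →L[ℝ] H) (D : G →L[ℝ] K) : G →L[ℝ] G →L[ℝ] ℝ :=
  (innerSL ℝ).bilinearComp J J - (innerSL ℝ).bilinearComp D D

lemma energyForm_apply (J : G →L[ℝ] H) (D : G →L[ℝ] K) (x y : G) :
    energyForm J D x y = inner ℝ (J x) (J y) - inner ℝ (D x) (D y) := by
  simp [energyForm]

lemma energyForm_comm (J : G →L[ℝ] H) (D : G →L[ℝ] K) (x y : G) :
    energyForm J D x y = energyForm J D y x := by
  simp only [energyForm_apply, real_inner_comm]

/-- A bounded family whose image under an injective operator converges, converges weakly. -/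
lemma tendsto_inner_of_injective {ι : Type*} {l : Filter ι} (J : G →L[ℝ] H)
    (hJ : Function.Injective J) {y : ι → G} {x : G} {R : ℝ} (hR : ∀ᶠ i in l, ‖y i‖ ≤ R)
    (hy : Tendsto (fun i => J (y i)) l (𝓝 (J x))) (w : G) :
    Tendsto (fun i => inner ℝ (y i) w) l (𝓝 (inner ℝ x w)) := by
  -- Injectivity of `J` makes the range of its adjoint dense. Against a vector of that range the
  -- claim is the convergence of `J (y i)`; the bound `R` absorbs the approximation error.
  have hdense : (ContinuousLinearMap.adjoint J).range.topologicalClosure = ⊤ := by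
    rw [Submodule.topologicalClosure_eq_top_iff, ContinuousLinearMap.orthogonal_range,
      ContinuousLinearMap.adjoint_adjoint]
    exact LinearMap.ker_eq_bot.2 hJ
  have hw : w ∈ closure ((ContinuousLinearMap.adjoint J).range : Set G) := by
    rw [← Submodule.topologicalClosure_coe, hdense]; trivial
  rw [Metric.tendsto_nhds]
  intro ε hε
  obtain ⟨_, ⟨z, rfl⟩, hz⟩ := Metric.mem_closure_iff.1 hw (ε / (2 * (|R| + ‖x‖ + 1)))
    (by positivity)
  have h1 : Tendsto (fun i => inner ℝ (J (y i)) z) l (𝓝 (inner ℝ (J x) z)) :=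
    hy.inner tendsto_const_nhds
  filter_upwards [Metric.tendsto_nhds.1 h1 (ε / 2) (by positivity), hR] with i hi hRi
  rw [Real.dist_eq] at hi ⊢
  have e1 : inner ℝ (y i) w - inner ℝ x w =
      (inner ℝ (J (y i)) z - inner ℝ (J x) z) +
        inner ℝ (y i - x) (w - (ContinuousLinearMap.adjoint J) z) := by
    simp only [inner_sub_left, inner_sub_right, ContinuousLinearMap.adjoint_inner_right,
      map_sub]
    ring
  rw [e1]
  have h2 := abs_real_inner_le_norm (y i - x) (w - (ContinuousLinearMap.adjoint J) z)
  have h3 : ‖y i - x‖ ≤ |R| + ‖x‖ + 1 := by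
    have := norm_sub_le (y i) x
    have := le_abs_self R
    linarith
  have hz' : ‖w - (ContinuousLinearMap.adjoint J) z‖ < ε / (2 * (|R| + ‖x‖ + 1)) := by
    rw [← dist_eq_norm]; exact hz
  have h4 : ‖y i - x‖ * ‖w - (ContinuousLinearMap.adjoint J) z‖ ≤ ε / 2 := by
    calc _ ≤ (|R| + ‖x‖ + 1) * (ε / (2 * (|R| + ‖x‖ + 1))) := by gcongr
      _ = ε / 2 := by field_simp
  calc _ ≤ _ := abs_add_le _ _
    _ < ε / 2 + ε / 2 := by linarith
    _ = ε := by ring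

/-- A doubly nonlinear gradient flow: `Ψ(v)` moves along the form `energyForm J D`, weakly, with the
structural inequalities of the nonlinearity `Ψ`. -/
structure IsGradientFlow (J : G →L[ℝ] H) (D : G →L[ℝ] K) (Ψ : H → H) (F : H → ℝ)
    (p C τ : ℝ) (g₀ : G) (g : ℝ → G) (v : ℝ → H) : Prop where
  injective : Function.Injective J
  norm_sq : ∀ x, ‖x‖ ^ 2 = ‖J x‖ ^ 2 + ‖D x‖ ^ 2
  p_pos : 0 < p
  C_nonneg : 0 ≤ C
  continuous_F : Continuous F
  -- `F`, seen as a function of `Ψ`, is convex with subgradient `y` at `Ψ y`.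
  convex : ∀ x y, inner ℝ (Ψ x - Ψ y) y ≤ F x - F y
  -- Cauchy–Schwarz for increments, with the quadratic parameter `c` left free so that it may depend
  -- on time. The term in `C` is the error made in replacing difference quotients of `Ψ` by its
  -- derivative at `x`; `c = 0` is monotonicity.
  coercive : ∀ x y (c : ℝ), 2 * c * inner ℝ (Ψ y - Ψ x) x -
    c ^ 2 * (p * F x + C * (1 + ‖x‖) * ‖y - x‖) ≤ inner ℝ (Ψ y - Ψ x) (y - x)
  tau_pos : 0 < τ
  integrable : Integrable g
  continuous_v : Continuous v
  ae_eq : ∀ᵐ t, t ∈ Ioo 0 τ → v t = J (g t)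
  initial : v 0 = J g₀
  evolution : ∀ s ∈ Icc 0 τ, ∀ t ∈ Icc 0 τ, ∀ w,
    inner ℝ (Ψ (v t) - Ψ (v s)) (J w) = energyForm J D (∫ r in s..t, g r) w

namespace IsGradientFlow

variable {J : G →L[ℝ] H} {D : G →L[ℝ] K} {Ψ : H → H} {F : H → ℝ} {p C τ : ℝ} {g₀ : G}
  {g : ℝ → G} {v : ℝ → H}

lemma norm_le (h : IsGradientFlow J D Ψ F p C τ g₀ g v) (x : G) : ‖x‖ ≤ ‖J x‖ + ‖D x‖ := by
  have := h.norm_sq x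
  have h1 := norm_nonneg (J x)
  have h2 := norm_nonneg (D x)
  exact abs_le_of_sq_le_sq' (by nlinarith) (by positivity) |>.2

/-- Cauchy–Schwarz in each of `H` and `K`, then in the plane for the pairs `(‖J x‖, ‖D x‖)` and `(‖J
y‖, ‖D y‖)`. -/
lemma abs_form_le (h : IsGradientFlow J D Ψ F p C τ g₀ g v) (x y : G) :
    |energyForm J D x y| ≤ ‖x‖ * ‖y‖ := by
  rw [energyForm_apply]
  have h1 := abs_real_inner_le_norm (J x) (J y)
  have h2 := abs_real_inner_le_norm (D x) (D y)
  have h3 : |inner ℝ (J x) (J y) - inner ℝ (D x) (D y)| ≤ ‖J x‖ * ‖J y‖ + ‖D x‖ * ‖D y‖ :=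
    (abs_sub _ _).trans (add_le_add h1 h2)
  refine h3.trans (abs_le_of_sq_le_sq' ?_ (by positivity)).2
  rw [mul_pow, h.norm_sq x, h.norm_sq y]
  nlinarith [sq_nonneg (‖J x‖ * ‖D y‖ - ‖D x‖ * ‖J y‖)]

lemma monotone_Ψ (h : IsGradientFlow J D Ψ F p C τ g₀ g v) (x y : H) :
    0 ≤ inner ℝ (Ψ y - Ψ x) (y - x) := by
  simpa using h.coercive x y 0

lemma intervalIntegrable (h : IsGradientFlow J D Ψ F p C τ g₀ g v) (a b : ℝ) :
    IntervalIntegrable g volume a b := h.integrable.intervalIntegrable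

lemma integral_sub (h : IsGradientFlow J D Ψ F p C τ g₀ g v) (s t : ℝ) :
    (∫ r in (0 : ℝ)..t, g r) - ∫ r in (0 : ℝ)..s, g r = ∫ r in s..t, g r :=
  intervalIntegral.integral_interval_sub_left (h.intervalIntegrable _ _)
    (h.intervalIntegrable _ _)

lemma continuous_integral (h : IsGradientFlow J D Ψ F p C τ g₀ g v) :
    Continuous fun t => ∫ r in (0 : ℝ)..t, g r :=
  intervalIntegral.continuous_primitive h.intervalIntegrable 0

lemma J_integral (h : IsGradientFlow J D Ψ F p C τ g₀ g v) {s t : ℝ} (hs : 0 ≤ s) (hst : s ≤ t)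
    (ht : t ≤ τ) : J (∫ r in s..t, g r) = ∫ r in s..t, v r := by
  rw [← ContinuousLinearMap.intervalIntegral_comp_comm J (h.intervalIntegrable _ _)]
  apply intervalIntegral.integral_congr_ae
  have hb : ∀ᵐ x : ℝ, x ≠ τ := by simp [ae_iff, measure_singleton]
  filter_upwards [h.ae_eq, hb] with r hr hrb hm
  rw [uIoc_of_le hst] at hm
  exact (hr ⟨hs.trans_lt hm.1, lt_of_le_of_ne (hm.2.trans ht) hrb⟩).symm

/-! ### Behaviour of the flow at the initial time -/

lemma norm_J_integral_le (h : IsGradientFlow J D Ψ F p C τ g₀ g v) {m : ℝ}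
    (hm : ∀ t ∈ Icc 0 τ, ‖v t‖ ≤ m) {t : ℝ} (ht : t ∈ Icc 0 τ) :
    ‖J (∫ r in (0 : ℝ)..t, g r)‖ ≤ m * t := by
  rw [h.J_integral le_rfl ht.1 ht.2]
  have := intervalIntegral.norm_integral_le_of_norm_le_const (a := 0) (b := t) (f := v) (C := m)
    (fun x hx => hm x (by rw [uIoc_of_le ht.1] at hx; exact ⟨hx.1.le, hx.2.trans ht.2⟩))
  rwa [sub_zero, abs_of_nonneg ht.1] at this

/-- Monotonicity of `Ψ` between the times `0` and `s`, once the evolution is tested with `g s - g₀`.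
-/
lemma ae_form_nonneg (h : IsGradientFlow J D Ψ F p C τ g₀ g v) :
    ∀ᵐ s, s ∈ Ioo 0 τ → 0 ≤ energyForm J D (∫ r in (0 : ℝ)..s, g r) (g s - g₀) := by
  filter_upwards [h.ae_eq] with s hs hm
  rw [← h.evolution 0 ⟨le_rfl, h.tau_pos.le⟩ s ⟨hm.1.le, hm.2.le⟩, map_sub, ← hs hm, ← h.initial]
  exact h.monotone_Ψ _ _

lemma intervalIntegrable_form (h : IsGradientFlow J D Ψ F p C τ g₀ g v) {W w : ℝ → G}
    (hW : Continuous W) (hw : Integrable w) {a b : ℝ} (hab : a ≤ b) :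
    IntervalIntegrable (fun s => energyForm J D (W s) (w s)) volume a b := by
  obtain ⟨M, hM⟩ := (isCompact_Icc (a := a) (b := b)).exists_bound_of_continuousOn hW.continuousOn
  refine (hw.norm.intervalIntegrable (a := a) (b := b)).const_mul M |>.mono_fun' ?_ ?_
  · exact (ContinuousLinearMap.aestronglyMeasurable_comp₂ (energyForm J D)
      hW.aestronglyMeasurable hw.aestronglyMeasurable.restrict)
  · rw [uIoc_of_le hab]
    refine (ae_restrict_iff' measurableSet_Ioc).2 (Eventually.of_forall fun s hs => ?_)
    refine (h.abs_form_le _ _).trans ?_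
    exact mul_le_mul_of_nonneg_right (hM s ⟨hs.1.le, hs.2⟩) (norm_nonneg _)

/-- For the primitive `V` of `g`, integrating `ae_form_nonneg` gives `B(V,V) = 2 ∫ B(V,g) ≥ 2 ∫
B(V,g₀)`. This controls `D V` without any bound on `D g`. -/
lemma norm_D_integral_sq_le (h : IsGradientFlow J D Ψ F p C τ g₀ g v) {t : ℝ}
    (ht : t ∈ Icc 0 τ) :
    ‖D (∫ r in (0 : ℝ)..t, g r)‖ ^ 2 ≤ ‖J (∫ r in (0 : ℝ)..t, g r)‖ ^ 2 -
      2 * ∫ s in (0 : ℝ)..t, energyForm J D (∫ r in (0 : ℝ)..s, g r) g₀ := by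
  set V : ℝ → G := fun t => ∫ r in (0 : ℝ)..t, g r with hV
  have hVc : Continuous V := h.continuous_integral
  have h1 := bilin_self_sub_eq_integral (energyForm J D) (energyForm_comm J D) h.integrable
    (W := V) (fun s t => h.integral_sub s t) ht.1
  have h0 : V 0 = 0 := by simp [hV]
  have hcont : Continuous fun s => energyForm J D (V s) := (energyForm J D).continuous.comp hVc
  have h2 : ∫ s in (0 : ℝ)..t, energyForm J D (V s) g₀ ≤
      ∫ s in (0 : ℝ)..t, energyForm J D (V s) (g s) := by
    refine intervalIntegral.integral_mono_ae_restrict ht.1 ?_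
      (h.intervalIntegrable_form hVc h.integrable ht.1) ?_
    · exact (hcont.clm_apply continuous_const).intervalIntegrable _ _
    · rw [Filter.EventuallyLE, ae_restrict_iff' measurableSet_Icc]
      have hb : ∀ᵐ x : ℝ, x ≠ τ := by simp [ae_iff, measure_singleton]
      have ha : ∀ᵐ x : ℝ, x ≠ 0 := by simp [ae_iff, measure_singleton]
      filter_upwards [h.ae_form_nonneg, ha, hb] with s hs hs0 hsτ hm
      have := hs ⟨lt_of_le_of_ne hm.1 (Ne.symm hs0), lt_of_le_of_ne (hm.2.trans ht.2) hsτ⟩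
      rw [map_sub] at this
      linarith
  rw [h0] at h1
  simp only [map_zero, sub_zero] at h1
  rw [energyForm_apply, real_inner_self_eq_norm_sq, real_inner_self_eq_norm_sq] at h1
  simp only [hV] at h1 h2 ⊢
  linarith

/-- Let `M` be the maximum of `‖D V‖` on `[0,t]`. The preceding estimate becomes `M² ≤ (m t)² + 2 (m
t + M) ‖g₀‖ t`, which forces `M ≤ (m + 2‖g₀‖) t`. -/
lemma exists_norm_integral_le (h : IsGradientFlow J D Ψ F p C τ g₀ g v) :
    ∃ R : ℝ, ∀ t ∈ Icc 0 τ, ‖∫ r in (0 : ℝ)..t, g r‖ ≤ R * t := by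
  obtain ⟨m, hm⟩ := (isCompact_Icc (a := 0) (b := τ)).exists_bound_of_continuousOn
    h.continuous_v.continuousOn
  have hm0 : 0 ≤ m := (norm_nonneg _).trans (hm 0 ⟨le_rfl, h.tau_pos.le⟩)
  refine ⟨m + (m + 2 * ‖g₀‖), fun t ht => ?_⟩
  set V : ℝ → G := fun t => ∫ r in (0 : ℝ)..t, g r with hV
  have hVc : Continuous V := h.continuous_integral
  obtain ⟨a, ha, hmax⟩ := (isCompact_Icc (a := 0) (b := t)).exists_isMaxOn
    (nonempty_Icc.2 ht.1) (D.continuous.comp hVc).norm.continuousOn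
  have haτ : a ∈ Icc 0 τ := ⟨ha.1, ha.2.trans ht.2⟩
  have hJ : ∀ s ∈ Icc 0 t, ‖J (V s)‖ ≤ m * t := fun s hs =>
    (h.norm_J_integral_le hm ⟨hs.1, hs.2.trans ht.2⟩).trans (by gcongr; exact hs.2)
  have hD : ∀ s ∈ Icc 0 t, ‖D (V s)‖ ≤ ‖D (V a)‖ := fun s hs => hmax hs
  have h1 := h.norm_D_integral_sq_le haτ
  have h2 : |∫ s in (0 : ℝ)..a, energyForm J D (V s) g₀| ≤ (m * t + ‖D (V a)‖) * ‖g₀‖ * t := by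
    have := intervalIntegral.norm_integral_le_of_norm_le_const (a := 0) (b := a)
      (f := fun s => energyForm J D (V s) g₀) (C := (m * t + ‖D (V a)‖) * ‖g₀‖) (fun s hs => by
        rw [uIoc_of_le ha.1] at hs
        have hs' : s ∈ Icc 0 t := ⟨hs.1.le, hs.2.trans ha.2⟩
        refine (h.abs_form_le _ _).trans ?_
        gcongr
        exact (h.norm_le _).trans (add_le_add (hJ s hs') (hD s hs')))
    rw [sub_zero, abs_of_nonneg ha.1] at this
    refine this.trans ?_
    have := ht.1
    gcongr
    exact ha.2
  have h3 := (abs_le.1 h2).1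
  have h4 := hJ a ha
  have hM : ‖D (V a)‖ ≤ (m + 2 * ‖g₀‖) * t := by
    by_contra hcon
    push Not at hcon
    have hc := norm_nonneg g₀
    have hJ2 : ‖J (V a)‖ ^ 2 ≤ (m * t) ^ 2 := by gcongr
    have ht0 := ht.1
    have e1 : ‖D (V a)‖ ^ 2 ≤ (m * t) ^ 2 + 2 * ((m * t + ‖D (V a)‖) * ‖g₀‖ * t) := by
      simp only [hV] at h1 h3 hJ2 ⊢; linarith
    have e2 : (m + 2 * ‖g₀‖) * t * (m * t) < ‖D (V a)‖ * (‖D (V a)‖ - 2 * ‖g₀‖ * t) := by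
      have e3 : m * t < ‖D (V a)‖ - 2 * ‖g₀‖ * t := by linarith
      have e4 : 0 ≤ (m + 2 * ‖g₀‖) * t := by positivity
      have e5 : 0 ≤ m * t := by positivity
      nlinarith
    nlinarith
  calc ‖V t‖ ≤ ‖J (V t)‖ + ‖D (V t)‖ := h.norm_le _
    _ ≤ m * t + (m + 2 * ‖g₀‖) * t :=
      add_le_add (hJ t ⟨ht.1, le_rfl⟩) ((hD t ⟨ht.1, le_rfl⟩).trans hM)
    _ = _ := by ring

lemma tendsto_J_average (h : IsGradientFlow J D Ψ F p C τ g₀ g v) :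
    Tendsto (fun t => J (t⁻¹ • ∫ r in (0 : ℝ)..t, g r)) (𝓝[>] 0) (𝓝 (J g₀)) := by
  have h1 : HasDerivWithinAt (fun t => ∫ r in (0 : ℝ)..t, v r) (v 0) (Ioi 0) 0 :=
    (intervalIntegral.integral_hasDerivAt_right (h.continuous_v.intervalIntegrable _ _)
      (h.continuous_v.stronglyMeasurableAtFilter _ _) h.continuous_v.continuousAt).hasDerivWithinAt
  rw [hasDerivWithinAt_iff_tendsto_slope' (by simp), h.initial] at h1
  refine h1.congr' ?_
  filter_upwards [Ioo_mem_nhdsGT h.tau_pos] with t ht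
  simp [slope, h.J_integral le_rfl ht.1.le ht.2.le]

/-- The time averages of the solution converge to the initial value in the energy norm. -/
lemma tendsto_average (h : IsGradientFlow J D Ψ F p C τ g₀ g v) :
    Tendsto (fun t => t⁻¹ • ∫ r in (0 : ℝ)..t, g r) (𝓝[>] 0) (𝓝 g₀) := by
  set V : ℝ → G := fun t => ∫ r in (0 : ℝ)..t, g r with hV
  set y : ℝ → G := fun t => t⁻¹ • V t with hy
  obtain ⟨R, hR⟩ := h.exists_norm_integral_le
  have hyR : ∀ᶠ t in 𝓝[>] (0 : ℝ), ‖y t‖ ≤ R := by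
    filter_upwards [Ioo_mem_nhdsGT h.tau_pos] with t ht
    have := hR t ⟨ht.1.le, ht.2.le⟩
    have ht0 := ht.1
    simp only [hy, norm_smul, norm_inv, Real.norm_eq_abs, abs_of_pos ht0]
    rw [inv_mul_le_iff₀ ht0, mul_comm]
    exact this
  have hJ := h.tendsto_J_average
  have hweak : ∀ w, Tendsto (fun t => inner ℝ (y t) w) (𝓝[>] 0) (𝓝 (inner ℝ g₀ w)) :=
    tendsto_inner_of_injective J h.injective hyR hJ
  have hDw : Tendsto (fun t => inner ℝ (D (y t)) (D g₀)) (𝓝[>] 0)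
      (𝓝 (inner ℝ (D g₀) (D g₀))) := by
    simpa only [← ContinuousLinearMap.adjoint_inner_right] using
      hweak ((ContinuousLinearMap.adjoint D) (D g₀))
  set L := energyForm J D g₀ g₀ with hL
  have hform : Tendsto (fun t => energyForm J D (y t) g₀) (𝓝[>] 0) (𝓝 L) := by
    simp only [hL, energyForm_apply]
    exact (hJ.inner tendsto_const_nhds).sub hDw
  -- Weak convergence gives `B(V(s), g₀) = s B(y(s), g₀) ≥ s (L - ε)` for small `s`, and `2 ∫_0^t s
  -- ds = t²` matches the scaling of `y`. In the limit `‖D y‖²` is at most `‖J g₀‖² - L = ‖D g₀‖²`,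
  -- which upgrades weak convergence to strong.
  have hbound : ∀ ε > 0, ∀ᶠ t in 𝓝[>] (0 : ℝ), ‖D (y t)‖ ^ 2 ≤ ‖J (y t)‖ ^ 2 - (L - ε) := by
    intro ε hε
    have h1 := hform.eventually (eventually_ge_nhds (show L - ε < L by linarith))
    obtain ⟨δ, hδ, h2⟩ := (mem_nhdsGT_iff_exists_Ioo_subset).1 h1
    filter_upwards [Ioo_mem_nhdsGT h.tau_pos, Ioo_mem_nhdsGT hδ] with t ht htδ
    have h3 : ∫ s in (0 : ℝ)..t, s * (L - ε) ≤ ∫ s in (0 : ℝ)..t, energyForm J D (V s) g₀ := by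
      refine intervalIntegral.integral_mono_on ht.1.le
        ((continuous_id.mul continuous_const).intervalIntegrable _ _)
        ((((energyForm J D).continuous.comp h.continuous_integral).clm_apply
          continuous_const).intervalIntegrable _ _) fun s hs => ?_
      rcases hs.1.eq_or_lt with rfl | hs0
      · simp [hV]
      · have h4 : L - ε ≤ energyForm J D (y s) g₀ := h2 ⟨hs0, hs.2.trans_lt htδ.2⟩
        simp only [hy, map_smul, _root_.smul_apply, smul_eq_mul] at h4
        rwa [le_inv_mul_iff₀ hs0] at h4
    rw [intervalIntegral.integral_mul_const, integral_id] at h3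
    have h5 := h.norm_D_integral_sq_le ⟨ht.1.le, ht.2.le⟩
    have ht0 := ht.1
    simp only [hy, map_smul, norm_smul, norm_inv, Real.norm_eq_abs, abs_of_pos ht0, mul_pow]
    have h6 : ‖D (V t)‖ ^ 2 ≤ ‖J (V t)‖ ^ 2 - t ^ 2 * (L - ε) := by
      simp only [hV] at h3 ⊢; linarith
    have h7 : t⁻¹ ^ 2 * (t ^ 2 * (L - ε)) = L - ε := by field_simp
    calc t⁻¹ ^ 2 * ‖D (V t)‖ ^ 2 ≤ t⁻¹ ^ 2 * (‖J (V t)‖ ^ 2 - t ^ 2 * (L - ε)) := by gcongr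
      _ = _ := by rw [mul_sub, h7]
  rw [tendsto_iff_norm_sub_tendsto_zero]
  have hsq : Tendsto (fun t => ‖y t - g₀‖ ^ 2) (𝓝[>] 0) (𝓝 0) := by
    have hup : Tendsto (fun t => ‖J (y t) - J g₀‖ ^ 2 + (‖J (y t)‖ ^ 2 - L -
        2 * inner ℝ (D (y t)) (D g₀) + ‖D g₀‖ ^ 2)) (𝓝[>] 0) (𝓝 0) := by
      have := ((hJ.sub_const (J g₀)).norm.pow 2).add
        ((((hJ.norm.pow 2).sub_const L).sub (hDw.const_mul 2)).add_const (‖D g₀‖ ^ 2))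
      convert this using 2
      simp only [hL, energyForm_apply, real_inner_self_eq_norm_sq, sub_self, norm_zero]
      ring
    rw [Metric.tendsto_nhds]
    intro ε hε
    filter_upwards [hbound (ε / 2) (by positivity),
      hup.eventually (gt_mem_nhds (show (0 : ℝ) < ε / 2 by positivity))] with t h1 h2
    rw [Real.dist_eq, sub_zero, abs_of_nonneg (by positivity), h.norm_sq, map_sub, map_sub,
      norm_sub_sq_real (D (y t))]
    linarith
  have := hsq.sqrt
  simpa [Real.sqrt_sq (norm_nonneg _)] using this

/-! ### Window integrals and monotonicity of the energy -/

lemma continuous_window (h : IsGradientFlow J D Ψ F p C τ g₀ g v) (δ : ℝ) :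
    Continuous fun s => ∫ r in s..(s + δ), g r := by
  have : (fun s => ∫ r in s..(s + δ), g r) =
      fun s => (∫ r in (0 : ℝ)..(s + δ), g r) - ∫ r in (0 : ℝ)..s, g r :=
    funext fun s => (h.integral_sub _ _).symm
  rw [this]
  exact (h.continuous_integral.comp (continuous_id.add continuous_const)).sub h.continuous_integral

/-- The variation of the energy of the window integrals. -/
lemma form_window_sub (h : IsGradientFlow J D Ψ F p C τ g₀ g v) (δ : ℝ) {a b : ℝ} (hab : a ≤ b) :
    energyForm J D (∫ r in b..(b + δ), g r) (∫ r in b..(b + δ), g r) -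
      energyForm J D (∫ r in a..(a + δ), g r) (∫ r in a..(a + δ), g r) =
      2 * ∫ s in a..b, energyForm J D (∫ r in s..(s + δ), g r) (g (s + δ) - g s) := by
  refine bilin_self_sub_eq_integral (energyForm J D) (energyForm_comm J D)
    (w := fun s => g (s + δ) - g s) (W := fun s => ∫ r in s..(s + δ), g r)
    ((h.integrable.comp_add_right δ).sub h.integrable) (fun s t => ?_) hab
  rw [intervalIntegral.integral_sub (h.integrable.comp_add_right δ).intervalIntegrable
    (h.intervalIntegrable _ _), intervalIntegral.integral_comp_add_right,
    ← h.integral_sub t, ← h.integral_sub s, ← h.integral_sub s, ← h.integral_sub (s + δ)]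
  abel

/-- Translation preserves null sets, so for almost every `s` the curve lifts at both `s` and `s +
δ`. The evolution may then be tested with `g s` and with `g (s + δ) - g s`. -/
lemma ae_coercive (h : IsGradientFlow J D Ψ F p C τ g₀ g v) {δ : ℝ} (hδ : 0 < δ) :
    ∀ᵐ s, s ∈ Ioo 0 (τ - δ) → ∀ c : ℝ,
      2 * c * energyForm J D (∫ r in s..(s + δ), g r) (g s) -
        c ^ 2 * (p * F (v s) + C * (1 + ‖v s‖) * ‖v (s + δ) - v s‖) ≤
      energyForm J D (∫ r in s..(s + δ), g r) (g (s + δ) - g s) := by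
  filter_upwards [h.ae_eq, (measurePreserving_add_right volume δ).quasiMeasurePreserving.ae h.ae_eq]
    with s h1 h2 hs c
  have hs1 : s ∈ Ioo 0 τ := ⟨hs.1, by linarith [hs.2]⟩
  have hs2 : s + δ ∈ Ioo 0 τ := ⟨by linarith [hs.1], by linarith [hs.2]⟩
  rw [← h.evolution s (Ioo_subset_Icc_self hs1) _ (Ioo_subset_Icc_self hs2),
    ← h.evolution s (Ioo_subset_Icc_self hs1) _ (Ioo_subset_Icc_self hs2), map_sub,
    ← h1 hs1, ← h2 hs2]
  exact h.coercive _ _ _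

/-- `x` is the right derivative of the primitive of `g` at `t`. -/
def IsRightValue (g : ℝ → G) (t : ℝ) (x : G) : Prop :=
  Tendsto (fun δ => δ⁻¹ • ∫ r in t..(t + δ), g r) (𝓝[>] 0) (𝓝 x)

lemma isRightValue_zero (h : IsGradientFlow J D Ψ F p C τ g₀ g v) : IsRightValue g 0 g₀ := by
  simpa [IsRightValue] using h.tendsto_average

lemma ae_hasDerivAt (h : IsGradientFlow J D Ψ F p C τ g₀ g v) :
    ∀ᵐ t, HasDerivAt (fun t => ∫ r in (0 : ℝ)..t, g r) (g t) t := by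
  filter_upwards [LocallyIntegrable.ae_hasDerivAt_integral h.integrable.locallyIntegrable]
    with t ht using ht 0

lemma ae_isRightValue (h : IsGradientFlow J D Ψ F p C τ g₀ g v) :
    ∀ᵐ t, IsRightValue g t (g t) := by
  filter_upwards [h.ae_hasDerivAt] with t ht
  have := (hasDerivAt_iff_tendsto_slope_zero.1 ht).mono_left (nhdsGT_le_nhdsNE 0)
  simpa only [IsRightValue, h.integral_sub] using this

lemma IsRightValue.tendsto_form {t : ℝ} {x : G} (hx : IsRightValue g t x) (J : G →L[ℝ] H)
    (D : G →L[ℝ] K) :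
    Tendsto (fun δ => δ⁻¹ ^ 2 * energyForm J D (∫ r in t..(t + δ), g r) (∫ r in t..(t + δ), g r))
      (𝓝[>] 0) (𝓝 (energyForm J D x x)) := by
  have hc : Continuous fun y : G => energyForm J D y y :=
    (energyForm J D).continuous.clm_apply continuous_id
  have := (hc.tendsto x).comp hx
  refine this.congr fun δ => ?_
  simp only [Function.comp_apply, map_smul, _root_.smul_apply, smul_eq_mul]
  ring

/-- The energy is nondecreasing along the flow. -/
lemma energy_mono (h : IsGradientFlow J D Ψ F p C τ g₀ g v) {a b : ℝ} (ha : 0 ≤ a) (hab : a ≤ b)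
    (hb : b < τ) {x y : G} (hx : IsRightValue g a x) (hy : IsRightValue g b y) :
    energyForm J D x x ≤ energyForm J D y y := by
  refine le_of_tendsto_of_tendsto (hx.tendsto_form J D) (hy.tendsto_form J D) ?_
  filter_upwards [Ioo_mem_nhdsGT (show (0 : ℝ) < τ - b by linarith)] with δ hδ
  have h1 := h.form_window_sub δ hab
  -- Half the growth of the window energy; the integrand is nonnegative by `ae_coercive` with `c =
  -- 0`.
  have h2 : 0 ≤ ∫ s in a..b, energyForm J D (∫ r in s..(s + δ), g r) (g (s + δ) - g s) := by
    apply intervalIntegral.integral_nonneg_of_ae_restrict hab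
    have ha' : ∀ᵐ x : ℝ, x ≠ 0 := by simp [ae_iff, measure_singleton]
    rw [Filter.EventuallyLE, ae_restrict_iff' measurableSet_Icc]
    filter_upwards [h.ae_coercive hδ.1, ha'] with s hs hs0 hm
    have := hs ⟨lt_of_le_of_ne (ha.trans hm.1) (Ne.symm hs0), by linarith [hδ.2, hm.2]⟩ 0
    simpa using this
  gcongr
  linarith

/-! ### Regularity of the flow and the dissipation identity -/

lemma ae_energy_ge (h : IsGradientFlow J D Ψ F p C τ g₀ g v) :
    ∀ᵐ t, t ∈ Ioo 0 τ → energyForm J D g₀ g₀ ≤ energyForm J D (g t) (g t) := by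
  filter_upwards [h.ae_isRightValue] with t ht hm
  exact h.energy_mono le_rfl hm.1.le hm.2 h.isRightValue_zero ht

/-- A lower bound on the energy is an upper bound on `‖D g‖²`, because `‖J g‖ = ‖v‖` is bounded on
the compact interval. -/
lemma exists_ae_norm_le (h : IsGradientFlow J D Ψ F p C τ g₀ g v) :
    ∃ M, 0 ≤ M ∧ ∀ᵐ t, t ∈ Ioo 0 τ → ‖g t‖ ≤ M := by
  obtain ⟨m, hm⟩ := (isCompact_Icc (a := 0) (b := τ)).exists_bound_of_continuousOn
    h.continuous_v.continuousOn
  refine ⟨√(2 * m ^ 2 - energyForm J D g₀ g₀), Real.sqrt_nonneg _, ?_⟩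
  filter_upwards [h.ae_energy_ge, h.ae_eq] with t h1 h2 ht
  apply Real.le_sqrt_of_sq_le
  have h3 := h1 ht
  rw [energyForm_apply J D (g t), real_inner_self_eq_norm_sq, real_inner_self_eq_norm_sq] at h3
  have h4 := hm t (Ioo_subset_Icc_self ht)
  rw [h2 ht] at h4
  have h5 : ‖J (g t)‖ ^ 2 ≤ m ^ 2 := by gcongr
  rw [h.norm_sq]
  linarith

lemma norm_integral_le (_h : IsGradientFlow J D Ψ F p C τ g₀ g v) {M : ℝ}
    (hM : ∀ᵐ t, t ∈ Ioo 0 τ → ‖g t‖ ≤ M) {s t : ℝ} (hs : s ∈ Icc 0 τ) (ht : t ∈ Icc 0 τ) :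
    ‖∫ r in s..t, g r‖ ≤ M * |t - s| := by
  refine intervalIntegral.norm_integral_le_of_norm_le_const_ae ?_
  have hb : ∀ᵐ x : ℝ, x ≠ τ := by simp [ae_iff, measure_singleton]
  filter_upwards [hM, hb] with r hr hrb hm
  exact hr ⟨(le_min hs.1 ht.1).trans_lt hm.1, lt_of_le_of_ne (hm.2.trans (max_le hs.2 ht.2)) hrb⟩

/-- Only the base point `s` has to be a time at which `v` lifts; `t` is arbitrary and may lie on
either side of `s`. -/
lemma ae_form_le_sub (h : IsGradientFlow J D Ψ F p C τ g₀ g v) :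
    ∀ᵐ s, s ∈ Ioo 0 τ → ∀ t ∈ Icc 0 τ,
      energyForm J D (∫ r in s..t, g r) (g s) ≤ F (v t) - F (v s) := by
  filter_upwards [h.ae_eq] with s hs hm t ht
  rw [← h.evolution s (Ioo_subset_Icc_self hm) t ht, ← hs hm]
  exact h.convex _ _

lemma abs_F_sub_le (h : IsGradientFlow J D Ψ F p C τ g₀ g v) {M : ℝ} (hM0 : 0 ≤ M)
    (hM : ∀ᵐ t, t ∈ Ioo 0 τ → ‖g t‖ ≤ M) {s t : ℝ} (hs : s ∈ Icc 0 τ) (ht : t ∈ Icc 0 τ) :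
    |F (v s) - F (v t)| ≤ M ^ 2 * |s - t| := by
  have hFv : Continuous fun t => F (v t) := h.continuous_F.comp h.continuous_v
  -- For fixed `t` the bound holds at almost every `s`, hence at every `s` by continuity; exchanging
  -- the times gives the other inequality.
  have key : ∀ t ∈ Icc 0 τ, ∀ s ∈ Icc 0 τ, F (v s) - M ^ 2 * |t - s| ≤ F (v t) := by
    intro t ht
    refine le_on_Icc_of_ae_le h.tau_pos (hFv.sub (by fun_prop)) continuous_const ?_
    filter_upwards [h.ae_form_le_sub, hM] with s h1 h2 hs
    have h3 := h1 hs t ht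
    have h4 := (abs_le.1 (h.abs_form_le (∫ r in s..t, g r) (g s))).1
    have h5 : ‖∫ r in s..t, g r‖ * ‖g s‖ ≤ M * |t - s| * M := by
      gcongr
      · exact h.norm_integral_le hM (Ioo_subset_Icc_self hs) ht
      · exact h2 hs
    nlinarith
  have h1 := key t ht s hs
  have h2 := key s hs t ht
  rw [abs_sub_comm t s] at h1
  rw [abs_le]
  constructor <;> linarith

lemma absolutelyContinuousOnInterval_F (h : IsGradientFlow J D Ψ F p C τ g₀ g v) :
    AbsolutelyContinuousOnInterval (fun t => F (v t)) 0 τ := by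
  obtain ⟨M, hM0, hM⟩ := h.exists_ae_norm_le
  have hlin : AbsolutelyContinuousOnInterval (fun t : ℝ => t) 0 τ :=
    (contDiff_id.contDiffOn (n := 1)).absolutelyContinuousOnInterval
  refine absolutelyContinuousOnInterval_of_dist_le (M ^ 2) hlin fun s hs t ht => ?_
  rw [uIcc_of_le h.tau_pos.le] at hs ht
  exact h.abs_F_sub_le hM0 hM hs ht

/-- The dissipation identity: the derivative of `F(v)` is the energy. -/
lemma ae_hasDerivAt_F (h : IsGradientFlow J D Ψ F p C τ g₀ g v) :
    ∀ᵐ t, t ∈ Ioo 0 τ →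
      HasDerivAt (fun t => F (v t)) (energyForm J D (g t) (g t)) t := by
  filter_upwards [h.absolutelyContinuousOnInterval_F.ae_differentiableAt, h.ae_hasDerivAt,
    h.ae_form_le_sub] with t h1 h2 h3 ht
  rw [uIcc_of_le h.tau_pos.le] at h1
  have hd := (h1 (Ioo_subset_Icc_self ht)).hasDerivAt
  have hslope := hasDerivAt_iff_tendsto_slope_zero.1 hd
  have hV := hasDerivAt_iff_tendsto_slope_zero.1 h2
  simp only [h.integral_sub] at hV
  have hform : Tendsto (fun δ => energyForm J D (δ⁻¹ • ∫ r in t..(t + δ), g r) (g t)) (𝓝[≠] 0)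
      (𝓝 (energyForm J D (g t) (g t))) :=
    ((((energyForm J D).continuous.clm_apply continuous_const).tendsto (g t)).comp hV)
  have hnear : ∀ᶠ δ in 𝓝 (0 : ℝ), t + δ ∈ Icc 0 τ := by
    have : Tendsto (fun δ => t + δ) (𝓝 0) (𝓝 t) := by
      have := (continuous_const_add t).tendsto 0
      simpa using this
    exact this.eventually (Icc_mem_nhds ht.1 ht.2)
  -- Convexity bounds the increment of `F(v)` from below. Division by `δ > 0` gives a lower bound
  -- for the derivative, and division by `δ < 0` in `e2` gives the upper one.
  have e1 : energyForm J D (g t) (g t) ≤ deriv (fun t => F (v t)) t := by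
    refine le_of_tendsto_of_tendsto (hform.mono_left (nhdsGT_le_nhdsNE 0))
      (hslope.mono_left (nhdsGT_le_nhdsNE 0)) ?_
    filter_upwards [self_mem_nhdsWithin, nhdsWithin_le_nhds hnear] with δ hδ hn
    have := h3 ht _ hn
    have hδ' : (0 : ℝ) < δ := hδ
    simp only [map_smul, _root_.smul_apply, smul_eq_mul]
    gcongr
  have e2 : deriv (fun t => F (v t)) t ≤ energyForm J D (g t) (g t) := by
    refine le_of_tendsto_of_tendsto (hslope.mono_left (nhdsLT_le_nhdsNE 0))
      (hform.mono_left (nhdsLT_le_nhdsNE 0)) ?_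
    filter_upwards [self_mem_nhdsWithin, nhdsWithin_le_nhds hnear] with δ hδ hn
    have := h3 ht _ hn
    have hδ' : δ⁻¹ < 0 := inv_lt_zero.2 hδ
    simp only [map_smul, _root_.smul_apply, smul_eq_mul]
    exact mul_le_mul_of_nonpos_left this hδ'.le
  rwa [le_antisymm e2 e1] at hd

lemma F_ge (h : IsGradientFlow J D Ψ F p C τ g₀ g v) (hE : 0 < energyForm J D g₀ g₀) {t : ℝ}
    (ht : t ∈ Icc 0 τ) : F (v 0) ≤ F (v t) := by
  have hsub : uIcc 0 t ⊆ uIcc 0 τ := by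
    rw [uIcc_of_le ht.1, uIcc_of_le h.tau_pos.le]; exact Icc_subset_Icc_right ht.2
  refine le_of_ae_hasDerivAt_nonneg ht.1 (h.absolutelyContinuousOnInterval_F.mono hsub)
    (f' := fun t => energyForm J D (g t) (g t)) ?_
  filter_upwards [h.ae_hasDerivAt_F, h.ae_energy_ge] with s h1 h2 hs
  have hs' : s ∈ Ioo 0 τ := ⟨hs.1, hs.2.trans_le ht.2⟩
  exact ⟨h1 hs', hE.le.trans (h2 hs')⟩

/-! ### Growth of the energy and decay of the power of `F` -/

lemma aestronglyMeasurable_energy (h : IsGradientFlow J D Ψ F p C τ g₀ g v) :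
    AEStronglyMeasurable (fun s => energyForm J D (g s) (g s)) volume :=
  ContinuousLinearMap.aestronglyMeasurable_comp₂ (energyForm J D)
    h.integrable.aestronglyMeasurable h.integrable.aestronglyMeasurable

/-- The growth of the energy, from the Cauchy–Schwarz inequality encoded in `coercive`. -/
lemma energy_growth (h : IsGradientFlow J D Ψ F p C τ g₀ g v) (hE : 0 < energyForm J D g₀ g₀)
    (hF : 0 < F (v 0)) {t : ℝ} (ht : t ∈ Ioo 0 τ) {x : G} (hx : IsRightValue g t x) :
    IntervalIntegrable (fun s => 2 * energyForm J D (g s) (g s) ^ 2 / (p * F (v s))) volume 0 t ∧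
    energyForm J D g₀ g₀ + ∫ s in (0 : ℝ)..t, 2 * energyForm J D (g s) (g s) ^ 2 / (p * F (v s)) ≤
      energyForm J D x x := by
  obtain ⟨M, hM0, hM⟩ := h.exists_ae_norm_le
  obtain ⟨m, hm⟩ := (isCompact_Icc (a := 0) (b := τ)).exists_bound_of_continuousOn
    h.continuous_v.continuousOn
  have hm0 : 0 ≤ m := (norm_nonneg _).trans (hm 0 ⟨le_rfl, h.tau_pos.le⟩)
  have hFv : Continuous fun t => F (v t) := h.continuous_F.comp h.continuous_v
  obtain ⟨A, hA⟩ := (isCompact_Icc (a := 0) (b := τ)).exists_bound_of_continuousOn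
    hFv.continuousOn
  have hA0 : 0 ≤ A := (norm_nonneg _).trans (hA 0 ⟨le_rfl, h.tau_pos.le⟩)
  have hp := h.p_pos
  have hC := h.C_nonneg
  have hvc := h.continuous_v
  set e : ℝ → ℝ := fun s => energyForm J D (g s) (g s) with he
  -- The maximiser of `c ↦ 2 c e - c² p F`, whose maximum is `e² / (p F)`.
  set κ : ℝ → ℝ := fun s => e s / (p * F (v s)) with hκ
  have hem : AEStronglyMeasurable e volume := h.aestronglyMeasurable_energy
  have hκm : AEStronglyMeasurable κ volume :=
    (hem.aemeasurable.div (continuous_const.mul hFv).measurable.aemeasurable).aestronglyMeasurable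
  set κ₀ := M ^ 2 / (p * F (v 0)) with hκ₀
  have hκb : ∀ᵐ s, s ∈ Ioo 0 τ → |κ s| ≤ κ₀ := by
    filter_upwards [hM] with s hs hsm
    have h1 := h.F_ge hE (Ioo_subset_Icc_self hsm)
    have h2 := h.abs_form_le (g s) (g s)
    have h3 := hs hsm
    have h4 : 0 < F (v s) := hF.trans_le h1
    rw [hκ, abs_div, abs_of_pos (mul_pos hp h4)]
    refine div_le_div₀ (by positivity) (h2.trans ?_) (by positivity) (by gcongr)
    rw [sq]; gcongr
  -- The lower bound of `ae_coercive` with `c = δ κ(s)`, divided by `δ²`. As `δ → 0` the window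
  -- average tends to `g s`, the error term vanishes, and `I` tends to `e² / (p F)` under the
  -- constant bound `B`.
  set I : ℝ → ℝ → ℝ := fun δ s => 2 * κ s * energyForm J D (δ⁻¹ • ∫ r in s..(s + δ), g r) (g s) -
    κ s ^ 2 * (p * F (v s) + C * (1 + ‖v s‖) * ‖v (s + δ) - v s‖) with hI
  have hIm : ∀ δ, AEStronglyMeasurable (I δ) volume := by
    intro δ
    have h1 : AEStronglyMeasurable
        (fun s => energyForm J D (δ⁻¹ • ∫ r in s..(s + δ), g r) (g s)) volume :=
      ContinuousLinearMap.aestronglyMeasurable_comp₂ (energyForm J D)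
        ((h.continuous_window δ).const_smul _).aestronglyMeasurable
        h.integrable.aestronglyMeasurable
    have h2 : Continuous fun s => p * F (v s) + C * (1 + ‖v s‖) * ‖v (s + δ) - v s‖ :=
      (continuous_const.mul hFv).add (by fun_prop)
    exact ((hκm.const_mul 2).mul h1).sub ((hκm.pow 2).mul h2.aestronglyMeasurable)
  set B : ℝ := 2 * κ₀ * (M * M) + κ₀ ^ 2 * (p * A + C * (1 + m) * (m + m)) with hB
  have hκ₀0 : 0 ≤ κ₀ := by positivity
  have hIb : ∀ δ ∈ Ioo 0 (τ - t), ∀ᵐ s, s ∈ Ioc 0 t → ‖I δ s‖ ≤ B := by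
    intro δ hδ
    filter_upwards [hκb, hM] with s h1 h2 hs
    have hs' : s ∈ Ioo 0 τ := ⟨hs.1, hs.2.trans_lt ht.2⟩
    have hs'' : s + δ ∈ Icc 0 τ := ⟨by linarith [hs.1, hδ.1], by linarith [hs.2, hδ.2]⟩
    have h3 : ‖δ⁻¹ • ∫ r in s..(s + δ), g r‖ ≤ M := by
      have := h.norm_integral_le hM (Ioo_subset_Icc_self hs') hs''
      rw [add_sub_cancel_left, abs_of_pos hδ.1] at this
      rw [norm_smul, norm_inv, Real.norm_eq_abs, abs_of_pos hδ.1, inv_mul_le_iff₀ hδ.1, mul_comm]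
      exact this
    have h4 := h.abs_form_le (δ⁻¹ • ∫ r in s..(s + δ), g r) (g s)
    have h5 : ‖v (s + δ) - v s‖ ≤ m + m :=
      (norm_sub_le _ _).trans (add_le_add (hm _ hs'') (hm _ (Ioo_subset_Icc_self hs')))
    have h6 := hA s (Ioo_subset_Icc_self hs')
    have h7 := hm s (Ioo_subset_Icc_self hs')
    have h8 := h1 hs'
    have h9 := h2 hs'
    have hFs : 0 < F (v s) := hF.trans_le (h.F_ge hE (Ioo_subset_Icc_self hs'))
    rw [Real.norm_eq_abs, abs_of_pos hFs] at h6
    refine (abs_sub _ _).trans ?_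
    rw [abs_mul, abs_mul, abs_mul, abs_pow, abs_two, hB,
      abs_of_nonneg (a := p * F (v s) + _) (by positivity)]
    have h10 : |energyForm J D (δ⁻¹ • ∫ r in s..(s + δ), g r) (g s)| ≤ M * M :=
      h4.trans (mul_le_mul h3 h9 (norm_nonneg _) hM0)
    gcongr
  have hlim : ∀ᵐ s, s ∈ Ioc 0 t → Tendsto (fun δ => I δ s) (𝓝[>] 0)
      (𝓝 (e s ^ 2 / (p * F (v s)))) := by
    filter_upwards [h.ae_isRightValue] with s h1 hs
    have hFs : 0 < F (v s) := hF.trans_le (h.F_ge hE ⟨hs.1.le, hs.2.trans ht.2.le⟩)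
    have h2 : Tendsto (fun δ => energyForm J D (δ⁻¹ • ∫ r in s..(s + δ), g r) (g s)) (𝓝[>] 0)
        (𝓝 (e s)) :=
      ((((energyForm J D).continuous.clm_apply continuous_const).tendsto (g s)).comp h1)
    have h3 : Tendsto (fun δ => p * F (v s) + C * (1 + ‖v s‖) * ‖v (s + δ) - v s‖) (𝓝[>] 0)
        (𝓝 (p * F (v s))) := by
      have hc : Continuous fun δ => p * F (v s) + C * (1 + ‖v s‖) * ‖v (s + δ) - v s‖ := by
        fun_prop
      have := (hc.tendsto 0).mono_left (nhdsWithin_le_nhds (s := Ioi 0))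
      simpa using this
    have h4 := (h2.const_mul (2 * κ s)).sub (h3.const_mul (κ s ^ 2))
    convert h4 using 2
    simp only [hκ]
    field_simp
    ring
  have hδev : ∀ᶠ δ in 𝓝[>] (0 : ℝ), δ ∈ Ioo 0 (τ - t) :=
    Ioo_mem_nhdsGT (by linarith [ht.2])
  have huI : uIoc 0 t = Ioc 0 t := uIoc_of_le ht.1.le
  have hconv : Tendsto (fun δ => ∫ s in (0 : ℝ)..t, I δ s) (𝓝[>] 0)
      (𝓝 (∫ s in (0 : ℝ)..t, e s ^ 2 / (p * F (v s)))) := by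
    refine intervalIntegral.tendsto_integral_filter_of_dominated_convergence (fun _ => B)
      (Eventually.of_forall fun δ => (hIm δ).restrict) ?_ intervalIntegrable_const ?_
    · filter_upwards [hδev] with δ hδ
      rw [huI]; exact hIb δ hδ
    · rw [huI]; exact hlim
  have hint0 : IntervalIntegrable (fun s => 2 * e s ^ 2 / (p * F (v s))) volume 0 t := by
    refine (intervalIntegrable_const (c := 2 * (M * M) * κ₀)).mono_fun' ?_ ?_
    · exact ((((hem.pow 2).const_mul 2).aemeasurable.div
        (continuous_const.mul hFv).measurable.aemeasurable).aestronglyMeasurable).restrict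
    · rw [huI, EventuallyLE, ae_restrict_iff' measurableSet_Ioc]
      filter_upwards [hκb, hM] with s h1 h2 hs
      have hs' : s ∈ Ioo 0 τ := ⟨hs.1, hs.2.trans_lt ht.2⟩
      have : 2 * e s ^ 2 / (p * F (v s)) = 2 * e s * κ s := by simp only [hκ]; ring
      rw [this, Real.norm_eq_abs, abs_mul, abs_mul, abs_two]
      have h3 : |e s| ≤ M * M := (h.abs_form_le _ _).trans
        (mul_le_mul (h2 hs') (h2 hs') (norm_nonneg _) hM0)
      have h4 := h1 hs'
      gcongr
  refine ⟨hint0, ?_⟩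
  have hcmp : ∀ᶠ δ in 𝓝[>] (0 : ℝ), 2 * ∫ s in (0 : ℝ)..t, I δ s ≤
      δ⁻¹ ^ 2 * energyForm J D (∫ r in t..(t + δ), g r) (∫ r in t..(t + δ), g r) -
      δ⁻¹ ^ 2 * energyForm J D (∫ r in (0 : ℝ)..(0 + δ), g r) (∫ r in (0 : ℝ)..(0 + δ), g r) := by
    filter_upwards [hδev] with δ hδ
    have hδ0 := hδ.1
    rw [← mul_sub, h.form_window_sub δ ht.1.le, mul_left_comm,
      ← intervalIntegral.integral_const_mul (δ⁻¹ ^ 2)]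
    refine mul_le_mul_of_nonneg_left ?_ zero_le_two
    refine intervalIntegral.integral_mono_ae_restrict ht.1.le ?_ ?_ ?_
    · refine (intervalIntegrable_const (c := B)).mono_fun' (hIm δ).restrict ?_
      rw [huI, EventuallyLE, ae_restrict_iff' measurableSet_Ioc]
      exact hIb δ hδ
    · exact (h.intervalIntegrable_form (h.continuous_window δ)
        ((h.integrable.comp_add_right δ).sub h.integrable) ht.1.le).const_mul _
    · have ha' : ∀ᵐ x : ℝ, x ≠ 0 := by simp [ae_iff, measure_singleton]
      rw [Filter.EventuallyLE, ae_restrict_iff' measurableSet_Icc]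
      filter_upwards [h.ae_coercive hδ0, ha'] with s hs hs0 hsm
      have h1 := hs ⟨lt_of_le_of_ne hsm.1 (Ne.symm hs0), by linarith [hsm.2, hδ.2]⟩ (δ * κ s)
      have h2 := mul_le_mul_of_nonneg_left h1 (show 0 ≤ δ⁻¹ ^ 2 by positivity)
      refine le_trans (le_of_eq ?_) h2
      simp only [hI, map_smul, _root_.smul_apply, smul_eq_mul]
      field_simp
  have hfin := le_of_tendsto_of_tendsto (hconv.const_mul 2)
    ((hx.tendsto_form J D).sub (h.isRightValue_zero.tendsto_form J D)) hcmp
  rw [← intervalIntegral.integral_const_mul] at hfin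
  simp only [mul_div_assoc] at hfin ⊢
  linarith

/-- The power of `F` along the flow decreases at least linearly. -/
theorem rpow_F_le (h : IsGradientFlow J D Ψ F p C τ g₀ g v) (hE : 0 < energyForm J D g₀ g₀)
    (hF : 0 < F (v 0)) {q : ℝ} (hq : q = 2 / p) (hq1 : 1 < q) {a : ℝ} (ha : a ∈ Ico 0 τ) :
    F (v a) ^ (1 - q) ≤
      F (v 0) ^ (1 - q) - (q - 1) * energyForm J D g₀ g₀ * F (v 0) ^ (-q) * a := by
  -- Since `a` need not be a good time, integrability up to `a` is taken from a good time `b` beyond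
  -- it.
  have hex : ∃ b ∈ Ioo a τ, IsRightValue g b (g b) := by
    by_contra hcon
    push Not at hcon
    have h0 : volume (Ioo a τ) = 0 := by
      rw [measure_eq_zero_iff_ae_notMem]
      filter_upwards [h.ae_isRightValue] with s hs hm
      exact hcon s hm hs
    rw [Real.volume_Ioo, ENNReal.ofReal_eq_zero] at h0
    linarith [ha.2]
  obtain ⟨b, hb, hbr⟩ := hex
  have hint := (h.energy_growth hE hF ⟨ha.1.trans_lt hb.1, hb.2⟩ hbr).1
  have hinta : IntervalIntegrable
      (fun s => 2 * energyForm J D (g s) (g s) ^ 2 / (p * F (v s))) volume 0 a :=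
    hint.mono_set (by
      rw [uIcc_of_le ha.1, uIcc_of_le (ha.1.trans hb.1.le)]
      exact Icc_subset_Icc_right hb.1.le)
  have hsub : uIcc 0 a ⊆ uIcc 0 τ := by
    rw [uIcc_of_le ha.1, uIcc_of_le h.tau_pos.le]; exact Icc_subset_Icc_right ha.2.le
  -- The energy of `g` is not known to be absolutely continuous. This primitive lies below it almost
  -- everywhere by `energy_growth` and serves as `G` in `rpow_le_of_energy_growth`.
  have hAC : AbsolutelyContinuousOnInterval (fun t => energyForm J D g₀ g₀ +
      ∫ s in (0 : ℝ)..t, 2 * energyForm J D (g s) (g s) ^ 2 / (p * F (v s))) 0 a :=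
    absolutelyContinuousOnInterval_of_dist_le 1
      (hinta.absolutelyContinuousOnInterval_intervalIntegral left_mem_uIcc)
      fun s _ t _ => by simp
  have hp := h.p_pos
  refine rpow_le_of_energy_growth (e := fun t => energyForm J D (g t) (g t)) hp hq hq1 ha.1 hF hE
    (h.absolutelyContinuousOnInterval_F.mono hsub) hAC rfl (by simp)
    (fun t ht => h.F_ge hE ⟨ht.1, ht.2.trans ha.2.le⟩) ?_ ?_ ?_ ?_
  · intro t ht
    have : 0 ≤ ∫ s in (0 : ℝ)..t, 2 * energyForm J D (g s) (g s) ^ 2 / (p * F (v s)) :=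
      intervalIntegral.integral_nonneg ht.1 fun s hs => by
        have := hF.trans_le (h.F_ge hE ⟨hs.1, (hs.2.trans ht.2).trans ha.2.le⟩)
        positivity
    linarith
  · filter_upwards [h.ae_hasDerivAt_F] with t h1 ht using h1 ⟨ht.1, ht.2.trans ha.2⟩
  · filter_upwards [hinta.ae_hasDerivAt_integral] with t h1 ht
    refine (h1 ?_ 0 left_mem_uIcc).const_add _
    rw [uIcc_of_le ha.1]
    exact Ioo_subset_Icc_self ht
  · filter_upwards [h.ae_isRightValue] with t h1 ht
    exact (h.energy_growth hE hF ⟨ht.1, ht.2.trans ha.2⟩ h1).2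

/-- The right derivative of `F` along the flow at the initial time is the initial energy. -/
theorem hasDerivWithinAt_F_zero (h : IsGradientFlow J D Ψ F p C τ g₀ g v) :
    HasDerivWithinAt (fun t => F (v t)) (energyForm J D g₀ g₀) (Ici 0) 0 := by
  rw [← hasDerivWithinAt_Ioi_iff_Ici, hasDerivWithinAt_iff_tendsto_slope' (by simp)]
  have hvc := h.continuous_v
  have hav := h.tendsto_average
  have hlow : Tendsto (fun t => energyForm J D (t⁻¹ • ∫ r in (0 : ℝ)..t, g r) g₀) (𝓝[>] 0)
      (𝓝 (energyForm J D g₀ g₀)) :=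
    (((energyForm J D).continuous.clm_apply continuous_const).tendsto g₀).comp hav
  have hsqint : Tendsto (fun t => t⁻¹ * ∫ r in (0 : ℝ)..t, ‖v r‖ ^ 2) (𝓝[>] 0)
      (𝓝 (‖J g₀‖ ^ 2)) := by
    have hc : Continuous fun r => ‖v r‖ ^ 2 := by fun_prop
    have h1 : HasDerivWithinAt (fun t => ∫ r in (0 : ℝ)..t, ‖v r‖ ^ 2) (‖v 0‖ ^ 2) (Ioi 0) 0 :=
      (intervalIntegral.integral_hasDerivAt_right (hc.intervalIntegrable _ _)
        (hc.stronglyMeasurableAtFilter _ _) hc.continuousAt).hasDerivWithinAt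
    rw [hasDerivWithinAt_iff_tendsto_slope' (by simp), h.initial] at h1
    exact h1.congr fun t => by simp [slope]
  -- Convexity gives the lower bound `hlow`. For the upper one, the energy is integrated after the
  -- estimate `-‖D g‖² ≤ -2 ⟨D g, D g₀⟩ + ‖D g₀‖²`, which is affine in `D g`, so that only the
  -- average of `g` enters.
  have hup : Tendsto (fun t => t⁻¹ * (∫ r in (0 : ℝ)..t, ‖v r‖ ^ 2) -
      2 * inner ℝ (D (t⁻¹ • ∫ r in (0 : ℝ)..t, g r)) (D g₀) + ‖D g₀‖ ^ 2) (𝓝[>] 0)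
      (𝓝 (energyForm J D g₀ g₀)) := by
    have := (hsqint.sub ((((D.continuous.tendsto g₀).comp hav).inner
      (tendsto_const_nhds (x := D g₀))).const_mul 2)).add_const (‖D g₀‖ ^ 2)
    have hval : energyForm J D g₀ g₀ = ‖J g₀‖ ^ 2 - 2 * inner ℝ (D g₀) (D g₀) + ‖D g₀‖ ^ 2 := by
      rw [energyForm_apply, real_inner_self_eq_norm_sq, real_inner_self_eq_norm_sq]
      ring
    rw [hval]
    exact this
  refine tendsto_of_tendsto_of_tendsto_of_le_of_le' hlow hup ?_ ?_
  · filter_upwards [Ioo_mem_nhdsGT h.tau_pos] with t ht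
    have ht0 := ht.1
    simp only [slope, sub_zero, vsub_eq_sub, smul_eq_mul, map_smul, _root_.smul_apply]
    gcongr
    rw [← h.evolution 0 ⟨le_rfl, h.tau_pos.le⟩ t (Ioo_subset_Icc_self ht), ← h.initial]
    exact h.convex _ _
  · filter_upwards [Ioo_mem_nhdsGT h.tau_pos] with t ht
    have ht0 := ht.1
    have hsub : uIcc 0 t ⊆ uIcc 0 τ := by
      rw [uIcc_of_le ht0.le, uIcc_of_le h.tau_pos.le]; exact Icc_subset_Icc_right ht.2.le
    have hder : ∀ᵐ s, s ∈ Ioo 0 t →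
        HasDerivAt (fun t => F (v t)) (energyForm J D (g s) (g s)) s := by
      filter_upwards [h.ae_hasDerivAt_F] with s hs hm using hs ⟨hm.1, hm.2.trans ht.2⟩
    have hAC := h.absolutelyContinuousOnInterval_F.mono hsub
    have h1 := integral_eq_sub_of_ae_hasDerivAt ht0.le hAC hder
    have hi1 : IntervalIntegrable (fun s => ‖v s‖ ^ 2) volume 0 t :=
      (by fun_prop : Continuous fun s => ‖v s‖ ^ 2).intervalIntegrable _ _
    have hDg : Integrable fun s => D (g s) := D.integrable_comp h.integrable
    have hi2 : IntervalIntegrable (fun s => 2 * inner ℝ (D (g s)) (D g₀)) volume 0 t :=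
      ((hDg.inner_const (D g₀)).const_mul 2).intervalIntegrable
    have h2 : ∫ s in (0 : ℝ)..t, energyForm J D (g s) (g s) ≤
        ∫ s in (0 : ℝ)..t, (‖v s‖ ^ 2 - 2 * inner ℝ (D (g s)) (D g₀) + ‖D g₀‖ ^ 2) := by
      refine intervalIntegral.integral_mono_ae_restrict ht0.le
        (intervalIntegrable_of_ae_hasDerivAt ht0.le hAC hder)
        ((hi1.sub hi2).add intervalIntegrable_const) ?_
      have ha' : ∀ᵐ x : ℝ, x ≠ 0 := by simp [ae_iff, measure_singleton]
      rw [Filter.EventuallyLE, ae_restrict_iff' measurableSet_Icc]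
      filter_upwards [h.ae_eq, ha'] with s hs hs0 hsm
      rw [hs ⟨lt_of_le_of_ne hsm.1 (Ne.symm hs0), hsm.2.trans_lt ht.2⟩, energyForm_apply,
        real_inner_self_eq_norm_sq, real_inner_self_eq_norm_sq]
      have := norm_sub_sq_real (D (g s)) (D g₀)
      have := sq_nonneg ‖D (g s) - D g₀‖
      linarith
    rw [intervalIntegral.integral_add (hi1.sub hi2) intervalIntegrable_const,
      intervalIntegral.integral_sub hi1 hi2, intervalIntegral.integral_const_mul,
      intervalIntegral.integral_const, h1] at h2
    have h3 : ∫ s in (0 : ℝ)..t, inner ℝ (D (g s)) (D g₀) =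
        inner ℝ (D (∫ s in (0 : ℝ)..t, g s)) (D g₀) := by
      have := ContinuousLinearMap.intervalIntegral_comp_comm
        (((innerSL ℝ) (D g₀)).comp D) (h.intervalIntegrable 0 t)
      simp only [ContinuousLinearMap.comp_apply, innerSL_apply_apply] at this
      simpa only [real_inner_comm] using this
    rw [h3] at h2
    simp only [slope, sub_zero, vsub_eq_sub, smul_eq_mul, map_smul, inner_smul_left] at h2 ⊢
    have h4 := mul_le_mul_of_nonneg_left h2 (inv_pos.2 ht0).le
    refine h4.trans (le_of_eq ?_)
    simp
    field_simp

end IsGradientFlow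

end AbstractFlow

/-! ### Pointwise inequalities for `ψ` -/

section PsiPointwise

variable {n : ℝ}

lemma psi_of_nonneg (hn : 0 < n) {a : ℝ} (ha : 0 ≤ a) : psi n a = a ^ (1 / (n + 1)) := by
  rcases ha.eq_or_lt with rfl | ha
  · rw [psi, mul_zero, Real.zero_rpow (by positivity)]
  · rw [psi, abs_of_pos ha]
    nth_rewrite 2 [← Real.rpow_one a]
    rw [← Real.rpow_add ha]
    congr 1
    field_simp
    ring

lemma psi_neg (n a : ℝ) : psi n (-a) = -psi n a := by
  simp [psi]

lemma abs_psi (hn : 0 < n) (a : ℝ) : |psi n a| = |a| ^ (1 / (n + 1)) := by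
  rw [← psi_of_nonneg hn (abs_nonneg a)]
  simp only [psi, abs_mul, abs_abs]
  rw [abs_of_nonneg (Real.rpow_nonneg (abs_nonneg a) _)]

lemma psi_mul_self (hn : 0 < n) (a : ℝ) : psi n a * a = |a| ^ ((n + 2) / (n + 1)) := by
  have h1 : psi n a * a = |psi n a| * |a| := by
    rw [← abs_mul]
    refine (abs_of_nonneg ?_).symm
    rw [psi, mul_assoc]
    exact mul_nonneg (Real.rpow_nonneg (abs_nonneg a) _) (mul_self_nonneg a)
  rw [h1, abs_psi hn]
  rcases (abs_nonneg a).eq_or_lt with ha | ha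
  · rw [← ha, mul_zero, Real.zero_rpow (by positivity)]
  · nth_rewrite 2 [← Real.rpow_one |a|]
    rw [← Real.rpow_add ha]
    congr 1
    field_simp
    ring

lemma abs_psi_le (hn : 0 < n) (a : ℝ) : |psi n a| ≤ 1 + |a| := by
  rw [abs_psi hn]
  have hβ : 1 / (n + 1) ≤ 1 := by rw [div_le_one (by positivity)]; linarith
  rcases le_total |a| 1 with h | h
  · have := Real.rpow_le_one (abs_nonneg a) h (show 0 ≤ 1 / (n + 1) by positivity)
    linarith [abs_nonneg a]
  · have := Real.rpow_le_rpow_of_exponent_le h hβ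
    rw [Real.rpow_one] at this
    linarith

lemma measurable_psi (n : ℝ) : Measurable (psi n) := by
  unfold psi
  exact ((measurable_id.abs).pow_const _).mul measurable_id

/-- Young's inequality with exponents `n+2` and `(n+2)/(n+1)` applied to `ψ(a) b`, since
`|ψ(a)|^{n+2} = |a|^{(n+2)/(n+1)}`. -/
lemma psi_convex (hn : 0 < n) (a b : ℝ) :
    (psi n a - psi n b) * b ≤
      1 / (n + 2) * (|a| ^ ((n + 2) / (n + 1)) - |b| ^ ((n + 2) / (n + 1))) := by
  rw [sub_mul, psi_mul_self hn]
  have hc : (n + 2).HolderConjugate ((n + 2) / (n + 1)) := by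
    rw [Real.holderConjugate_iff]
    refine ⟨by linarith, ?_⟩
    field_simp
    ring
  have h1 := Real.young_inequality_of_nonneg (abs_nonneg (psi n a)) (abs_nonneg b) hc
  rw [abs_psi hn, ← Real.rpow_mul (abs_nonneg a)] at h1
  have h2 : psi n a * b ≤ |a| ^ (1 / (n + 1)) * |b| := by
    rw [← abs_psi hn, ← abs_mul]; exact le_abs_self _
  have h3 : 1 / (n + 1) * (n + 2) = (n + 2) / (n + 1) := by ring
  rw [h3] at h1
  refine (sub_le_sub_right (h2.trans h1) _).trans (le_of_eq ?_)
  field_simp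
  ring

/-- The difference quotient of `ψ` at `1` exceeds `ψ'(1) = 1/(n+1)` by at most `4 |r - 1|`. For `r ≥
1` this is Bernoulli's inequality. -/
lemma psi_slope_one (hn : 0 < n) (r : ℝ) :
    0 ≤ (psi n r - 1) * (r - 1) ∧
    (psi n r - 1) * (r - 1) ≤ (1 / (n + 1) + 4 * |r - 1|) * (r - 1) ^ 2 := by
  set β := 1 / (n + 1) with hβ
  have hβ0 : 0 < β := by positivity
  have hβ1 : β ≤ 1 := by rw [hβ, div_le_one (by positivity)]; linarith
  rcases le_or_gt 1 r with h1 | h1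
  · rw [psi_of_nonneg hn (by linarith), ← hβ]
    have h2 : 1 ≤ r ^ β := Real.one_le_rpow h1 hβ0.le
    have h3 : r ^ β ≤ 1 + β * (r - 1) := by
      have := rpow_one_add_le_one_add_mul_self (s := r - 1) (by linarith) hβ0.le hβ1
      rwa [add_sub_cancel] at this
    refine ⟨mul_nonneg (by linarith) (by linarith), ?_⟩
    rw [abs_of_nonneg (by linarith)]
    have h4 : 0 ≤ r - 1 := by linarith
    have : (r ^ β - 1) * (r - 1) ≤ (β * (r - 1)) * (r - 1) := by gcongr; linarith
    nlinarith [mul_nonneg h4 (mul_nonneg h4 h4)]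
  · have habs : |r - 1| = 1 - r := by rw [abs_of_neg (by linarith)]; ring
    rw [habs]
    suffices h : psi n r ≤ 1 ∧ 1 - psi n r ≤ (β + 4 * (1 - r)) * (1 - r) by
      refine ⟨by nlinarith [h.1], ?_⟩
      have h5 : 0 ≤ 1 - r := by linarith
      have := mul_le_mul_of_nonneg_right h.2 h5
      nlinarith
    rcases le_or_gt 0 r with h0 | h0
    · rw [psi_of_nonneg hn h0, ← hβ]
      have h2 : r ^ β ≤ 1 := Real.rpow_le_one h0 h1.le hβ0.le
      have h2' : 0 ≤ r ^ β := Real.rpow_nonneg h0 _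
      refine ⟨h2, ?_⟩
      -- For `r ≥ 1/2`, Bernoulli is applied to `r⁻¹`, with `r⁻¹ ≤ 1 + 2 (1 - r)`. Below `1/2` the
      -- term `4 (1 - r)²` already exceeds `1`, and for negative `r` it absorbs the linear bound on
      -- `ψ`.
      rcases le_or_gt (1 / 2) r with h3 | h3
      · have hr : 0 < r := by linarith
        have h4 := rpow_one_add_le_one_add_mul_self (s := r⁻¹ - 1) (p := β)
          (by have := inv_pos.2 hr; linarith) hβ0.le hβ1
        rw [add_sub_cancel, Real.inv_rpow h0, inv_le_iff_one_le_mul₀ (by positivity)] at h4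
        have h5 : r⁻¹ ≤ 1 + 2 * (1 - r) := by
          rw [inv_le_iff_one_le_mul₀ hr]; nlinarith
        have h6 : r⁻¹ - 1 = r⁻¹ * (1 - r) := by field_simp
        have h7 : 0 ≤ 1 - r := by linarith
        have h8 : r⁻¹ * (1 - r) ≤ (1 + 2 * (1 - r)) * (1 - r) := by gcongr
        have h9 : 0 ≤ r⁻¹ * (1 - r) := by positivity
        rw [h6] at h4
        have h10 : β * (r⁻¹ * (1 - r)) * r ^ β ≤ β * (r⁻¹ * (1 - r)) :=
          mul_le_of_le_one_right (by positivity) h2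
        nlinarith [mul_nonneg h7 h7, mul_le_mul_of_nonneg_left h8 hβ0.le]
      · nlinarith
    · obtain ⟨t, rfl⟩ : ∃ t, r = -t := ⟨-r, by ring⟩
      have ht : 0 < t := by linarith
      rw [psi_neg]
      have h2 := abs_psi_le hn t
      rw [abs_of_pos ht] at h2
      have h3 := (le_abs_self (psi n t)).trans h2
      have h4 : 0 ≤ psi n t := by rw [psi_of_nonneg hn ht.le]; positivity
      refine ⟨by linarith, ?_⟩
      nlinarith [mul_pos hβ0 ht]

lemma psi_mul (hn : 0 < n) {a : ℝ} (ha : 0 < a) (r : ℝ) :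
    psi n (r * a) = psi n r * a ^ (1 / (n + 1)) := by
  rcases le_total 0 r with hr | hr
  · rw [psi_of_nonneg hn (by positivity), psi_of_nonneg hn hr, Real.mul_rpow hr ha.le]
  · obtain ⟨t, rfl⟩ : ∃ t, r = -t := ⟨-r, by ring⟩
    have ht : 0 ≤ t := by linarith
    rw [neg_mul, psi_neg, psi_neg, psi_of_nonneg hn (by positivity), psi_of_nonneg hn ht,
      Real.mul_rpow ht ha.le, neg_mul]

/-- Homogeneity and oddness of `ψ` reduce this to `psi_slope_one` with `r = b/a`. The inequality
bounds `k a²`, `k` being the difference quotient of `ψ`, in a form that avoids dividing by `a` or `b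
- a`. -/
lemma psi_slope (hn : 0 < n) (a b : ℝ) :
    0 ≤ (psi n b - psi n a) * (b - a) ∧
    (psi n b - psi n a) * (b - a) * a ^ 2 ≤
      (1 / (n + 1) * |a| ^ ((n + 2) / (n + 1)) + 4 * (|psi n a| * |b - a|)) * (b - a) ^ 2 := by
  have key : ∀ a b : ℝ, 0 < a → 0 ≤ (psi n b - psi n a) * (b - a) ∧
      (psi n b - psi n a) * (b - a) * a ^ 2 ≤
      (1 / (n + 1) * |a| ^ ((n + 2) / (n + 1)) + 4 * (|psi n a| * |b - a|)) * (b - a) ^ 2 := by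
    intro a b ha
    obtain ⟨r, rfl⟩ : ∃ r, b = r * a := ⟨b / a, by field_simp⟩
    have hψ := psi_of_nonneg hn ha.le
    rw [psi_mul hn ha, ← psi_mul_self hn a, hψ]
    set A := a ^ (1 / (n + 1)) with hA
    have hA0 : 0 < A := Real.rpow_pos_of_pos ha _
    obtain ⟨h1, h2⟩ := psi_slope_one hn r
    have e1 : (psi n r * A - A) * (r * a - a) = A * a * ((psi n r - 1) * (r - 1)) := by ring
    have e2 : |r * a - a| = |r - 1| * a := by
      rw [show r * a - a = (r - 1) * a by ring, abs_mul, abs_of_pos ha]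
    rw [e1, e2, abs_of_pos hA0]
    refine ⟨by positivity, ?_⟩
    have := mul_le_mul_of_nonneg_left h2 (show 0 ≤ A * a * a ^ 2 by positivity)
    calc _ = A * a * a ^ 2 * ((psi n r - 1) * (r - 1)) := by ring
      _ ≤ _ := this
      _ = _ := by ring
  rcases lt_trichotomy a 0 with ha | rfl | ha
  · have := key (-a) (-b) (by linarith)
    rw [psi_neg, psi_neg, abs_neg, abs_neg] at this
    have e : |-b - -a| = |b - a| := by rw [show -b - -a = -(b - a) by ring, abs_neg]
    rw [e] at this
    constructor
    · calc _ ≤ _ := this.1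
        _ = _ := by ring
    · calc _ = (-psi n b - -psi n a) * (-b - -a) * (-a) ^ 2 := by ring
        _ ≤ _ := this.2
        _ = _ := by ring
  · have h0 : psi n 0 = 0 := by simp [psi]
    rw [h0, sub_zero, sub_zero, psi_mul_self hn]
    refine ⟨Real.rpow_nonneg (abs_nonneg _) _, ?_⟩
    rw [zero_pow two_ne_zero, mul_zero]
    positivity
  · exact key a b ha

/-- With `k` the difference quotient of `ψ`, expand `k (b - a - c a)² ≥ 0` and bound `k a²` by
`psi_slope`. -/
lemma psi_coercive (hn : 0 < n) (a b c : ℝ) :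
    2 * c * ((psi n b - psi n a) * a) -
      c ^ 2 * (1 / (n + 1) * |a| ^ ((n + 2) / (n + 1)) + 4 * (|psi n a| * |b - a|)) ≤
      (psi n b - psi n a) * (b - a) := by
  obtain ⟨h1, h2⟩ := psi_slope hn a b
  set Q := 1 / (n + 1) * |a| ^ ((n + 2) / (n + 1)) + 4 * (|psi n a| * |b - a|) with hQ
  have hQ0 : 0 ≤ Q := by positivity
  rcases eq_or_ne b a with rfl | hne
  · simp only [sub_self, zero_mul, mul_zero]
    have := mul_nonneg (sq_nonneg c) hQ0
    linarith
  · have hd : 0 < (b - a) ^ 2 := by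
      have := sub_ne_zero.2 hne
      positivity
    rw [← sub_nonneg]
    refine nonneg_of_mul_nonneg_left ?_ hd
    have e : ((psi n b - psi n a) * (b - a) -
        (2 * c * ((psi n b - psi n a) * a) - c ^ 2 * Q)) * (b - a) ^ 2 =
        (psi n b - psi n a) * (b - a) * (b - a - c * a) ^ 2 +
        c ^ 2 * (Q * (b - a) ^ 2 - (psi n b - psi n a) * (b - a) * a ^ 2) := by ring
    rw [e]
    have := sub_nonneg.2 h2
    positivity

end PsiPointwise

/-! ### The operator `ψ` and the functional `F` on `L²` -/

section PsiLp

variable {α : Type*} [MeasurableSpace α] {μ : Measure α} {n : ℝ}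

lemma inner_Lp_eq (u w : Lp ℝ 2 μ) : inner ℝ u w = ∫ x, u x * w x ∂μ := by
  rw [L2.inner_def]
  exact integral_congr_ae (Eventually.of_forall fun x => by simp [mul_comm])

lemma integrable_Lp_mul (u w : Lp ℝ 2 μ) : Integrable (fun x => u x * w x) μ :=
  (Lp.memLp u).integrable_mul (Lp.memLp w)

variable [IsFiniteMeasure μ]

lemma memLp_psi (hn : 0 < n) (u : Lp ℝ 2 μ) : MemLp (fun x => psi n (u x)) 2 μ := by
  have h1 : MemLp (fun x => 1 + |u x|) 2 μ := (memLp_const (1 : ℝ)).add (Lp.memLp u).norm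
  refine h1.mono ((measurable_psi n).comp_aemeasurable
    (Lp.aestronglyMeasurable u).aemeasurable).aestronglyMeasurable (Eventually.of_forall fun x => ?_)
  rw [Real.norm_eq_abs, Real.norm_eq_abs, abs_of_nonneg (a := 1 + |u x|) (by positivity)]
  exact abs_psi_le hn _

/-- The Nemytskii operator `u ↦ ψ(u)` on `L²`. -/
def psiLp (hn : 0 < n) (u : Lp ℝ 2 μ) : Lp ℝ 2 μ := (memLp_psi hn u).toLp _

/-- The functional `(n+2)⁻¹ ∫ |u|^{(n+2)/(n+1)}`. -/
def powInt (n : ℝ) (u : Lp ℝ 2 μ) : ℝ := 1 / (n + 2) * ∫ x, |u x| ^ ((n + 2) / (n + 1)) ∂μ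

lemma psiLp_ae (hn : 0 < n) (u : Lp ℝ 2 μ) : ∀ᵐ x ∂μ, psiLp hn u x = psi n (u x) :=
  (memLp_psi hn u).coeFn_toLp

lemma integrable_rpow (hn : 0 < n) (u : Lp ℝ 2 μ) :
    Integrable (fun x => |u x| ^ ((n + 2) / (n + 1))) μ := by
  refine (integrable_Lp_mul (psiLp hn u) u).congr ?_
  filter_upwards [psiLp_ae hn u] with x hx
  rw [hx, psi_mul_self hn]

lemma inner_psiLp_self (hn : 0 < n) (u : Lp ℝ 2 μ) :
    inner ℝ (psiLp hn u) u = (n + 2) * powInt n u := by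
  rw [inner_Lp_eq, powInt, ← mul_assoc, mul_one_div_cancel (by positivity), one_mul]
  refine integral_congr_ae ?_
  filter_upwards [psiLp_ae hn u] with x hx
  rw [hx, psi_mul_self hn]

lemma psiLp_convex (hn : 0 < n) (u w : Lp ℝ 2 μ) :
    inner ℝ (psiLp hn u - psiLp hn w) w ≤ powInt n u - powInt n w := by
  rw [inner_Lp_eq, powInt, powInt, ← mul_sub, ← integral_sub (integrable_rpow hn u)
    (integrable_rpow hn w), ← integral_const_mul]
  refine integral_mono_ae (integrable_Lp_mul _ _)
    (((integrable_rpow hn u).sub (integrable_rpow hn w)).const_mul _) ?_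
  filter_upwards [psiLp_ae hn u, psiLp_ae hn w, Lp.coeFn_sub (psiLp hn u) (psiLp hn w)]
    with x h1 h2 h3
  rw [h3, Pi.sub_apply, h1, h2]
  exact psi_convex hn _ _

lemma norm_psiLp_le (hn : 0 < n) (u : Lp ℝ 2 μ) :
    ‖psiLp hn u‖ ≤ ‖Lp.const 2 μ (1 : ℝ)‖ + ‖u‖ := by
  have h : ‖psiLp hn u‖ ≤ ‖Lp.const 2 μ (1 : ℝ) + |u|‖ := by
    refine Lp.norm_le_norm_of_ae_le ?_
    filter_upwards [psiLp_ae hn u, Lp.coeFn_add (Lp.const 2 μ (1 : ℝ)) |u|, Lp.coeFn_abs u,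
      Lp.coeFn_const (p := 2) (μ := μ) (1 : ℝ)] with x h1 h2 h3 h4
    rw [h1, h2, Pi.add_apply, h3, h4, Real.norm_eq_abs, Real.norm_eq_abs]
    refine (abs_psi_le hn _).trans (le_abs_self _)
  exact h.trans ((norm_add_le _ _).trans (by rw [norm_abs_eq_norm]))

lemma psiLp_coercive (hn : 0 < n) (u w : Lp ℝ 2 μ) (c : ℝ) :
    2 * c * inner ℝ (psiLp hn w - psiLp hn u) u -
      c ^ 2 * ((n + 2) / (n + 1) * powInt n u +
        4 * (‖Lp.const 2 μ (1 : ℝ)‖ + 1) * (1 + ‖u‖) * ‖w - u‖) ≤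
      inner ℝ (psiLp hn w - psiLp hn u) (w - u) := by
  have h1 : (∫ x, (2 * c * ((psiLp hn w - psiLp hn u) x * u x) -
      c ^ 2 * (1 / (n + 1) * |u x| ^ ((n + 2) / (n + 1)) +
        4 * (|psiLp hn u| x * |w - u| x))) ∂μ) ≤
      ∫ x, (psiLp hn w - psiLp hn u) x * (w - u) x ∂μ := by
    refine integral_mono_ae (((integrable_Lp_mul _ _).const_mul _).sub
      ((((integrable_rpow hn u).const_mul _).add
        ((integrable_Lp_mul _ _).const_mul 4)).const_mul _)) (integrable_Lp_mul _ _) ?_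
    filter_upwards [psiLp_ae hn u, psiLp_ae hn w, Lp.coeFn_sub (psiLp hn w) (psiLp hn u),
      Lp.coeFn_sub w u, Lp.coeFn_abs (psiLp hn u), Lp.coeFn_abs (w - u)] with x h1 h2 h3 h4 h5 h6
    rw [h5, h6, h3, h4, Pi.sub_apply, Pi.sub_apply, h1, h2]
    exact psi_coercive hn _ _ _
  have hadd : Integrable (fun x => 1 / (n + 1) * |u x| ^ ((n + 2) / (n + 1)) +
      4 * (|psiLp hn u| x * |w - u| x)) μ :=
    ((integrable_rpow hn u).const_mul _).add ((integrable_Lp_mul _ _).const_mul 4)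
  rw [integral_sub ((integrable_Lp_mul _ _).const_mul _) (hadd.const_mul _),
    integral_const_mul, integral_const_mul,
    integral_add ((integrable_rpow hn u).const_mul _) ((integrable_Lp_mul _ _).const_mul 4),
    integral_const_mul, integral_const_mul, ← inner_Lp_eq, ← inner_Lp_eq, ← inner_Lp_eq] at h1
  refine le_trans ?_ h1
  have h2 : (n + 2) / (n + 1) * powInt n u =
      1 / (n + 1) * ∫ x, |u x| ^ ((n + 2) / (n + 1)) ∂μ := by
    rw [powInt]; field_simp
  have h3 : inner ℝ |psiLp hn u| |w - u| ≤
      (‖Lp.const 2 μ (1 : ℝ)‖ + 1) * (1 + ‖u‖) * ‖w - u‖ := by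
    refine (real_inner_le_norm _ _).trans ?_
    rw [norm_abs_eq_norm, norm_abs_eq_norm]
    refine mul_le_mul_of_nonneg_right ((norm_psiLp_le hn u).trans ?_) (norm_nonneg _)
    nlinarith [norm_nonneg u, norm_nonneg (Lp.const 2 μ (1 : ℝ))]
  rw [h2]
  have h4 := mul_le_mul_of_nonneg_left h3 (sq_nonneg c)
  linarith

lemma continuous_powInt (hn : 0 < n) : Continuous (powInt (μ := μ) n) := by
  -- Convexity combined with Euler's identity `⟨ψ(u), u⟩ = (n+2) F(u)`.
  have key : ∀ u w : Lp ℝ 2 μ, (n + 1) * (powInt n w - powInt n u) ≤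
      ‖psiLp hn w‖ * ‖w - u‖ := by
    intro u w
    have h1 := psiLp_convex hn w u
    rw [inner_sub_left, inner_psiLp_self] at h1
    have h2 := real_inner_le_norm (psiLp hn w) (w - u)
    rw [inner_sub_right, inner_psiLp_self] at h2
    linarith
  set c₀ := ‖Lp.const 2 μ (1 : ℝ)‖ with hc₀
  have hbound : ∀ u w : Lp ℝ 2 μ, |powInt n w - powInt n u| ≤
      (c₀ + ‖u‖ + ‖w‖) * ‖w - u‖ := by
    intro u w
    have h1 := (key u w).trans (mul_le_mul_of_nonneg_right (norm_psiLp_le hn w) (norm_nonneg _))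
    have h2 := (key w u).trans (mul_le_mul_of_nonneg_right (norm_psiLp_le hn u) (norm_nonneg _))
    rw [norm_sub_rev u w] at h2
    have h3 : 0 ≤ ‖u‖ * ‖w - u‖ := by positivity
    have h4 : 0 ≤ ‖w‖ * ‖w - u‖ := by positivity
    have h5 : 0 ≤ c₀ * ‖w - u‖ := by positivity
    rw [abs_le]
    constructor
    · by_contra hcon
      push Not at hcon
      nlinarith
    · by_contra hcon
      push Not at hcon
      nlinarith
  rw [continuous_iff_continuousAt]
  intro u
  rw [ContinuousAt, tendsto_iff_norm_sub_tendsto_zero]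
  have hlim : Tendsto (fun w : Lp ℝ 2 μ => (c₀ + ‖u‖ + ‖w‖) * ‖w - u‖) (𝓝 u) (𝓝 0) := by
    have hc : Continuous fun w : Lp ℝ 2 μ => (c₀ + ‖u‖ + ‖w‖) * ‖w - u‖ := by fun_prop
    simpa using hc.tendsto u
  exact squeeze_zero (fun _ => norm_nonneg _) (fun w => hbound u w) hlim

end PsiLp

/-! ### Calculus of `D̃^m` on smooth and test functions -/

section TestCalculus

variable {N : ℕ}

/-- Smoothness of a real function on `ℝ^N`. -/
abbrev Smooth (f : Space N → ℝ) : Prop := ContDiff ℝ ((⊤ : ℕ∞) : WithTop ℕ∞) f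

/-- The derivative of `f` in the direction `e`. -/
def dirDeriv (e : Space N) (f : Space N → ℝ) : Space N → ℝ := fun x => fderiv ℝ f x e

lemma Smooth.directional {f : Space N → ℝ} (hf : Smooth f) (e : Space N) :
    Smooth (dirDeriv e f) :=
  (ContDiff.fderiv_right (m := ((⊤ : ℕ∞) : WithTop ℕ∞)) hf (by simp)).clm_apply contDiff_const

lemma Smooth.differentiable {f : Space N → ℝ} (hf : Smooth f) : Differentiable ℝ f :=
  ContDiff.differentiable hf (by simp)

lemma dirDeriv_add {f g : Space N → ℝ} (hf : Smooth f) (hg : Smooth g) (e : Space N) :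
    dirDeriv e (f + g) = dirDeriv e f + dirDeriv e g := by
  funext x
  simp [dirDeriv, fderiv_add (hf.differentiable x) (hg.differentiable x)]

lemma dirDeriv_smul {f : Space N → ℝ} (hf : Smooth f) (c : ℝ) (e : Space N) :
    dirDeriv e (c • f) = c • dirDeriv e f := by
  funext x
  simp [dirDeriv, fderiv_const_smul (hf.differentiable x)]

lemma dirDeriv_sum {ι : Type*} (s : Finset ι) {f : ι → Space N → ℝ} (hf : ∀ i, Smooth (f i))
    (e : Space N) : dirDeriv e (∑ i ∈ s, f i) = ∑ i ∈ s, dirDeriv e (f i) := by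
  funext x
  simp [dirDeriv, fderiv_sum fun i _ => (hf i).differentiable x]

lemma dirDeriv_dirDeriv_apply {f : Space N → ℝ} (hf : Smooth f) (a b x : Space N) :
    dirDeriv a (dirDeriv b f) x = fderiv ℝ (fderiv ℝ f) x a b := by
  have h1 : Differentiable ℝ (fderiv ℝ f) :=
    (ContDiff.fderiv_right (m := ((⊤ : ℕ∞) : WithTop ℕ∞)) hf (by simp)).differentiable (by simp)
  have h2 : fderiv ℝ (fun y => fderiv ℝ f y b) x a = fderiv ℝ (fderiv ℝ f) x a b := by
    rw [fderiv_clm_apply (h1 x) (differentiableAt_const b)]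
    simp
  exact h2

lemma dirDeriv_comm {f : Space N → ℝ} (hf : Smooth f) (a b : Space N) :
    dirDeriv a (dirDeriv b f) = dirDeriv b (dirDeriv a f) := by
  funext x
  rw [dirDeriv_dirDeriv_apply hf, dirDeriv_dirDeriv_apply hf]
  refine ContDiffAt.isSymmSndFDerivAt (n := ((⊤ : ℕ∞) : WithTop ℕ∞)) hf.contDiffAt ?_ a b
  rw [minSmoothness_of_isRCLikeNormedField]
  exact WithTop.coe_le_coe.2 le_top

/-- The `i`-th unit vector. -/
abbrev unitVec (i : Fin N) : Space N := EuclideanSpace.single i 1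

lemma laplacian_eq_sum {f : Space N → ℝ} (hf : Smooth f) :
    (Laplacian.laplacian f : Space N → ℝ) =
      ∑ i, dirDeriv (unitVec i) (dirDeriv (unitVec i) f) := by
  rw [InnerProductSpace.laplacian_eq_iteratedFDeriv_orthonormalBasis f
    (EuclideanSpace.basisFun (Fin N) ℝ)]
  funext x
  rw [Finset.sum_apply]
  refine Finset.sum_congr rfl fun i _ => ?_
  rw [dirDeriv_dirDeriv_apply hf, iteratedFDeriv_two_apply]
  simp

lemma Smooth.lap {f : Space N → ℝ} (hf : Smooth f) :
    Smooth (Laplacian.laplacian f : Space N → ℝ) := by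
  rw [laplacian_eq_sum hf]
  have : (∑ i, dirDeriv (unitVec i) (dirDeriv (unitVec i) f)) =
      fun x => ∑ i, dirDeriv (unitVec i) (dirDeriv (unitVec i) f) x := by
    funext x; rw [Finset.sum_apply]
  rw [this]
  exact ContDiff.sum fun i _ => (hf.directional _).directional _

lemma lapPow_succ (k : ℕ) (f : Space N → ℝ) :
    lapPow (k + 1) f = Laplacian.laplacian (lapPow k f) := by
  simp only [lapPow, Function.iterate_succ_apply']

lemma Smooth.lapIter {f : Space N → ℝ} (hf : Smooth f) (k : ℕ) : Smooth (lapPow k f) := by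
  induction k with
  | zero => exact hf
  | succ k ih => rw [lapPow_succ]; exact ih.lap

lemma laplacian_dirDeriv {f : Space N → ℝ} (hf : Smooth f) (e : Space N) :
    (Laplacian.laplacian (dirDeriv e f) : Space N → ℝ) = dirDeriv e (Laplacian.laplacian f) := by
  rw [laplacian_eq_sum hf, laplacian_eq_sum (hf.directional e),
    dirDeriv_sum _ fun i => (hf.directional _).directional _]
  refine Finset.sum_congr rfl fun i _ => ?_
  rw [dirDeriv_comm hf, dirDeriv_comm (hf.directional _)]

lemma lapPow_dirDeriv {f : Space N → ℝ} (hf : Smooth f) (e : Space N) (k : ℕ) :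
    lapPow k (dirDeriv e f) = dirDeriv e (lapPow k f) := by
  induction k with
  | zero => rfl
  | succ k ih => rw [lapPow_succ, ih, laplacian_dirDeriv (hf.lapIter k), lapPow_succ]

lemma lapPow_add {f g : Space N → ℝ} (hf : Smooth f) (hg : Smooth g) (k : ℕ) :
    lapPow k (f + g) = lapPow k f + lapPow k g := by
  induction k with
  | zero => rfl
  | succ k ih =>
    have hs : Smooth (lapPow k f + lapPow k g) := ContDiff.add (hf.lapIter k) (hg.lapIter k)
    rw [lapPow_succ, ih, lapPow_succ, lapPow_succ, laplacian_eq_sum hs,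
      laplacian_eq_sum (hf.lapIter k), laplacian_eq_sum (hg.lapIter k), ← Finset.sum_add_distrib]
    refine Finset.sum_congr rfl fun i _ => ?_
    rw [dirDeriv_add (hf.lapIter k) (hg.lapIter k),
      dirDeriv_add ((hf.lapIter k).directional _) ((hg.lapIter k).directional _)]

lemma lapPow_smul {f : Space N → ℝ} (hf : Smooth f) (c : ℝ) (k : ℕ) :
    lapPow k (c • f) = c • lapPow k f := by
  induction k with
  | zero => rfl
  | succ k ih =>
    have hs : Smooth (c • lapPow k f) := ContDiff.const_smul c (hf.lapIter k)
    rw [lapPow_succ, ih, lapPow_succ, laplacian_eq_sum hs,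
      laplacian_eq_sum (hf.lapIter k), Finset.smul_sum]
    refine Finset.sum_congr rfl fun i _ => ?_
    rw [dirDeriv_smul (hf.lapIter k), dirDeriv_smul ((hf.lapIter k).directional _)]

lemma tildeDComp_none (m : ℕ) (f : Space N → ℝ) :
    tildeDComp m f none = if Even m then lapPow (m / 2) f else 0 := by
  funext x; by_cases h : Even m <;> simp [tildeDComp, h]

lemma tildeDComp_some (m : ℕ) (f : Space N → ℝ) (i : Fin N) :
    tildeDComp m f (some i) = if Even m then 0 else dirDeriv (unitVec i) (lapPow (m / 2) f) := by
  funext x; by_cases h : Even m <;> simp [tildeDComp, h, dirDeriv]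

lemma tildeDComp_add {f g : Space N → ℝ} (hf : Smooth f) (hg : Smooth g) (m : ℕ)
    (i : Option (Fin N)) : tildeDComp m (f + g) i = tildeDComp m f i + tildeDComp m g i := by
  rcases i with _ | i
  · simp only [tildeDComp_none, lapPow_add hf hg]; split_ifs <;> simp
  · simp only [tildeDComp_some, lapPow_add hf hg, dirDeriv_add (hf.lapIter _) (hg.lapIter _)]
    split_ifs <;> simp

lemma tildeDComp_smul {f : Space N → ℝ} (hf : Smooth f) (c : ℝ) (m : ℕ)
    (i : Option (Fin N)) : tildeDComp m (c • f) i = c • tildeDComp m f i := by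
  rcases i with _ | i
  · simp only [tildeDComp_none, lapPow_smul hf]; split_ifs <;> simp
  · simp only [tildeDComp_some, lapPow_smul hf, dirDeriv_smul (hf.lapIter _)]
    split_ifs <;> simp

/-! Bounds by the full derivative. -/

lemma norm_iteratedFDeriv_dirDeriv_le {f : Space N → ℝ} (hf : Smooth f) {e : Space N}
    (he : ‖e‖ ≤ 1) (j : ℕ) (x : Space N) :
    ‖iteratedFDeriv ℝ j (dirDeriv e f) x‖ ≤ ‖iteratedFDeriv ℝ (j + 1) f x‖ := by
  have h1 : ContDiff ℝ ((⊤ : ℕ∞) : WithTop ℕ∞) (fderiv ℝ f) :=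
    ContDiff.fderiv_right (m := ((⊤ : ℕ∞) : WithTop ℕ∞)) hf (by simp)
  have h2 := (ContinuousLinearMap.apply ℝ ℝ e).norm_iteratedFDeriv_comp_left (x := x) (n := j)
    h1.contDiffAt (WithTop.coe_le_coe.2 le_top)
  have h3 : ‖ContinuousLinearMap.apply ℝ ℝ e‖ ≤ 1 :=
    ContinuousLinearMap.opNorm_le_bound _ zero_le_one fun L => by
      have := L.le_opNorm e
      simp only [ContinuousLinearMap.apply_apply]
      nlinarith [norm_nonneg L, norm_nonneg e]
  rw [← norm_iteratedFDeriv_fderiv]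
  refine h2.trans ?_
  have := norm_nonneg (iteratedFDeriv ℝ j (fderiv ℝ f) x)
  nlinarith

lemma norm_unitVec (i : Fin N) : ‖(unitVec i : Space N)‖ ≤ 1 := by simp

lemma norm_iteratedFDeriv_laplacian_le {f : Space N → ℝ} (hf : Smooth f) (j : ℕ) (x : Space N) :
    ‖iteratedFDeriv ℝ j (Laplacian.laplacian f : Space N → ℝ) x‖ ≤
      N * ‖iteratedFDeriv ℝ (j + 2) f x‖ := by
  have hs : (Laplacian.laplacian f : Space N → ℝ) =
      fun x => ∑ i, dirDeriv (unitVec i) (dirDeriv (unitVec i) f) x := by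
    rw [laplacian_eq_sum hf]; funext x; rw [Finset.sum_apply]
  rw [hs, iteratedFDeriv_sum fun i _ =>
    ContDiff.of_le ((hf.directional _).directional _) (WithTop.coe_le_coe.2 le_top), Finset.sum_apply]
  refine (norm_sum_le _ _).trans ?_
  have : ∀ i ∈ (Finset.univ : Finset (Fin N)),
      ‖iteratedFDeriv ℝ j (dirDeriv (unitVec i) (dirDeriv (unitVec i) f)) x‖ ≤
      ‖iteratedFDeriv ℝ (j + 2) f x‖ := fun i _ =>
    (norm_iteratedFDeriv_dirDeriv_le (hf.directional _) (norm_unitVec i) j x).trans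
      (norm_iteratedFDeriv_dirDeriv_le hf (norm_unitVec i) (j + 1) x)
  refine (Finset.sum_le_sum this).trans (le_of_eq ?_)
  simp

lemma norm_iteratedFDeriv_lapPow_le {f : Space N → ℝ} (hf : Smooth f) (k j : ℕ) (x : Space N) :
    ‖iteratedFDeriv ℝ j (lapPow k f) x‖ ≤ N ^ k * ‖iteratedFDeriv ℝ (j + 2 * k) f x‖ := by
  induction k generalizing j with
  | zero => simp [lapPow]
  | succ k ih =>
    rw [lapPow_succ]
    refine (norm_iteratedFDeriv_laplacian_le (hf.lapIter k) j x).trans ?_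
    have := mul_le_mul_of_nonneg_left (ih (j + 2)) (Nat.cast_nonneg (α := ℝ) N)
    refine this.trans (le_of_eq ?_)
    rw [show j + 2 + 2 * k = j + 2 * (k + 1) by ring]
    ring

/-- Each Laplacian is a sum of `N` second derivatives, whence the power of `N`. The bound transfers
`L²` convergence of derivatives of order `m` to `D̃^m`. -/
lemma abs_tildeDComp_le {f : Space N → ℝ} (hf : Smooth f) (m : ℕ) (i : Option (Fin N))
    (x : Space N) :
    |tildeDComp m f i x| ≤ N ^ (m / 2) * ‖iteratedFDeriv ℝ m f x‖ := by
  rcases i with _ | i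
  · rw [tildeDComp_none]
    split_ifs with hm
    · have := norm_iteratedFDeriv_lapPow_le hf (m / 2) 0 x
      rwa [norm_iteratedFDeriv_zero, zero_add, Nat.two_mul_div_two_of_even hm] at this
    · simp only [Pi.zero_apply, abs_zero]; positivity
  · rw [tildeDComp_some]
    split_ifs with hm
    · simp only [Pi.zero_apply, abs_zero]; positivity
    · have h1 := norm_iteratedFDeriv_dirDeriv_le (hf.lapIter (m / 2)) (norm_unitVec i) 0 x
      have h2 := norm_iteratedFDeriv_lapPow_le hf (m / 2) 1 x
      have h3 : 1 + 2 * (m / 2) = m := by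
        have := Nat.odd_iff.1 (Nat.not_even_iff_odd.1 hm); omega
      rw [h3] at h2
      rw [norm_iteratedFDeriv_zero] at h1
      exact h1.trans h2

lemma norm_tildeD_le {f : Space N → ℝ} (hf : Smooth f) (m : ℕ) (x : Space N) :
    ‖tildeD m f x‖ ≤ (N + 1) * N ^ (m / 2) * ‖iteratedFDeriv ℝ m f x‖ := by
  set B := (N : ℝ) ^ (m / 2) * ‖iteratedFDeriv ℝ m f x‖ with hB
  have hB0 : 0 ≤ B := by positivity
  rw [mul_assoc, ← hB, EuclideanSpace.norm_eq]
  refine (Real.sqrt_le_left (by positivity)).2 ?_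
  have : ∀ i ∈ (Finset.univ : Finset (Option (Fin N))), ‖(tildeD m f x) i‖ ^ 2 ≤ B ^ 2 :=
    fun i _ => by
      have := abs_tildeDComp_le hf m i x
      simp only [tildeD, Real.norm_eq_abs]
      gcongr
  refine (Finset.sum_le_sum this).trans ?_
  simp only [Finset.sum_const, Finset.card_univ, Fintype.card_option, Fintype.card_fin,
    nsmul_eq_mul, Nat.cast_add, Nat.cast_one]
  have hN : (0 : ℝ) ≤ N := Nat.cast_nonneg N
  have h2 : 0 ≤ B ^ 2 := sq_nonneg B
  nlinarith [mul_nonneg hN h2, mul_nonneg (mul_nonneg hN hN) h2]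

/-! Compactly supported functions and integration by parts. -/

/-- Smooth functions with compact support in `Ω`. -/
structure IsTest (Ω : Opens (Space N)) (f : Space N → ℝ) : Prop where
  smooth : Smooth f
  compact : HasCompactSupport f
  subset : tsupport f ⊆ Ω

variable {Ω : Opens (Space N)}

lemma isTest (φ : 𝓓(Ω, ℝ)) : IsTest Ω φ := ⟨φ.contDiff, φ.hasCompactSupport, φ.tsupport_subset⟩

lemma IsTest.directional {f : Space N → ℝ} (hf : IsTest Ω f) (e : Space N) :
    IsTest Ω (dirDeriv e f) :=
  ⟨hf.smooth.directional e, hf.compact.fderiv_apply ℝ e,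
    (tsupport_fderiv_apply_subset ℝ e).trans hf.subset⟩

lemma isTest_zero : IsTest Ω (0 : Space N → ℝ) :=
  ⟨contDiff_const, HasCompactSupport.zero, by simp⟩

lemma IsTest.add {f g : Space N → ℝ} (hf : IsTest Ω f) (hg : IsTest Ω g) : IsTest Ω (f + g) :=
  ⟨ContDiff.add hf.smooth hg.smooth, hf.compact.add hg.compact,
    (tsupport_add f g).trans (union_subset hf.subset hg.subset)⟩

lemma IsTest.sum {ι : Type*} (s : Finset ι) {f : ι → Space N → ℝ} (hf : ∀ i, IsTest Ω (f i)) :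
    IsTest Ω (∑ i ∈ s, f i) :=
  Finset.sum_induction f (IsTest Ω) (fun _ _ => IsTest.add) isTest_zero fun i _ => hf i

lemma IsTest.lap {f : Space N → ℝ} (hf : IsTest Ω f) :
    IsTest Ω (Laplacian.laplacian f : Space N → ℝ) := by
  rw [laplacian_eq_sum hf.smooth]
  exact IsTest.sum _ fun i => (hf.directional _).directional _

lemma IsTest.lapIter {f : Space N → ℝ} (hf : IsTest Ω f) (k : ℕ) : IsTest Ω (lapPow k f) := by
  induction k with
  | zero => exact hf
  | succ k ih => rw [lapPow_succ]; exact ih.lap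

lemma IsTest.tilde {f : Space N → ℝ} (hf : IsTest Ω f) (m : ℕ) (i : Option (Fin N)) :
    IsTest Ω (tildeDComp m f i) := by
  rcases i with _ | i
  · rw [tildeDComp_none]; split_ifs
    exacts [hf.lapIter _, isTest_zero]
  · rw [tildeDComp_some]; split_ifs
    exacts [isTest_zero, (hf.lapIter _).directional _]

lemma IsTest.continuous {f : Space N → ℝ} (hf : IsTest Ω f) : Continuous f :=
  ContDiff.continuous hf.smooth

lemma IsTest.integrable_mul {f g : Space N → ℝ} (hf : IsTest Ω f) (hg : IsTest Ω g) :
    Integrable (fun x => f x * g x) :=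
  (hf.continuous.mul hg.continuous).integrable_of_hasCompactSupport hf.compact.mul_right

lemma IsTest.eq_zero_of_notMem {f : Space N → ℝ} (hf : IsTest Ω f) {x : Space N}
    (hx : x ∉ (Ω : Set (Space N))) : f x = 0 :=
  image_eq_zero_of_notMem_tsupport fun h => hx (hf.subset h)

lemma IsTest.integral_mul_dirDeriv {f g : Space N → ℝ} (hf : IsTest Ω f) (hg : IsTest Ω g)
    (e : Space N) :
    ∫ x, f x * dirDeriv e g x =
      -∫ x, dirDeriv e f x * g x :=
  integral_mul_fderiv_eq_neg_fderiv_mul_of_integrable ((hf.directional e).integrable_mul hg)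
    (hf.integrable_mul (hg.directional e)) (hf.integrable_mul hg)
    (fun x _ => hf.smooth.differentiable x) (fun x _ => hg.smooth.differentiable x)

lemma IsTest.integral_mul_laplacian {f g : Space N → ℝ} (hf : IsTest Ω f) (hg : IsTest Ω g) :
    ∫ x, f x * (Laplacian.laplacian g : Space N → ℝ) x =
      ∫ x, (Laplacian.laplacian f : Space N → ℝ) x * g x := by
  rw [laplacian_eq_sum hf.smooth, laplacian_eq_sum hg.smooth]
  simp only [Finset.sum_apply, Finset.mul_sum, Finset.sum_mul]
  rw [integral_finsetSum _ fun i _ => hf.integrable_mul ((hg.directional _).directional _),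
    integral_finsetSum _ fun i _ => ((hf.directional _).directional _).integrable_mul hg]
  refine Finset.sum_congr rfl fun i _ => ?_
  rw [hf.integral_mul_dirDeriv (hg.directional _), (hf.directional _).integral_mul_dirDeriv hg, neg_neg]

lemma IsTest.integral_mul_lapPow {f g : Space N → ℝ} (hf : IsTest Ω f) (hg : IsTest Ω g) (k : ℕ) :
    ∫ x, f x * lapPow k g x = ∫ x, lapPow k f x * g x := by
  induction k generalizing f with
  | zero => rfl
  | succ k ih =>
    rw [lapPow_succ, hf.integral_mul_laplacian (hg.lapIter k), ih hf.lap]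
    simp only [lapPow, Function.iterate_succ_apply]

lemma IsTest.integral_mul_tildeDComp {f g : Space N → ℝ} (hf : IsTest Ω f) (hg : IsTest Ω g)
    (m : ℕ) (i : Option (Fin N)) :
    ∫ x, f x * tildeDComp m g i x =
      (-1) ^ m * ∫ x, tildeDComp m f i x * g x := by
  rcases i with _ | i
  · simp only [tildeDComp_none]
    split_ifs with hm
    · rw [hm.neg_one_pow, one_mul, hf.integral_mul_lapPow hg]
    · simp
  · simp only [tildeDComp_some]
    split_ifs with hm
    · simp
    · rw [(Nat.not_even_iff_odd.1 hm).neg_one_pow, hf.integral_mul_dirDeriv (hg.lapIter _),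
        (hf.directional _).integral_mul_lapPow hg, lapPow_dirDeriv hf.smooth, neg_one_mul]

lemma IsTest.setIntegral_mul {f : Space N → ℝ} (hf : IsTest Ω f) (u : Space N → ℝ) :
    ∫ x in (Ω : Set (Space N)), u x * f x = ∫ x, u x * f x :=
  setIntegral_eq_integral_of_forall_compl_eq_zero fun x hx => by
    rw [hf.eq_zero_of_notMem hx, mul_zero]

end TestCalculus

/-! ### The energy space as the closure of the graph of `D̃^m` -/

section GraphSpace

variable {N : ℕ} {Ω : Opens (Space N)}

lemma IsTest.memLp {f : Space N → ℝ} (hf : IsTest Ω f) :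
    MemLp f 2 (volume.restrict (Ω : Set (Space N))) :=
  (hf.continuous.memLp_of_hasCompactSupport hf.compact).restrict _

lemma memLp_iteratedFDeriv (j : ℕ) (φ : 𝓓(Ω, ℝ)) :
    MemLp (iteratedFDeriv ℝ j φ) 2 (volume.restrict (Ω : Set (Space N))) :=
  ((φ.contDiff.continuous_iteratedFDeriv (WithTop.coe_le_coe.2 le_top)).memLp_of_hasCompactSupport
    (φ.hasCompactSupport.iteratedFDeriv (𝕜 := ℝ) j)).restrict _

lemma continuous_tildeD (m : ℕ) (φ : 𝓓(Ω, ℝ)) : Continuous (tildeD m φ) :=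
  (PiLp.continuous_toLp 2 _).comp
    (continuous_pi fun i => ((isTest φ).tilde m i).continuous)

lemma memLp_tildeD (m : ℕ) (φ : 𝓓(Ω, ℝ)) :
    MemLp (tildeD m φ) 2 (volume.restrict (Ω : Set (Space N))) :=
  (memLp_iteratedFDeriv m φ).of_le_mul (continuous_tildeD m φ).aestronglyMeasurable
    (Eventually.of_forall fun x => norm_tildeD_le (isTest φ).smooth m x)

lemma tildeD_add (m : ℕ) (φ χ : 𝓓(Ω, ℝ)) : tildeD m (φ + χ : 𝓓(Ω, ℝ)) = tildeD m φ + tildeD m χ := by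
  funext x
  ext i
  have := congrFun (tildeDComp_add (isTest φ).smooth (isTest χ).smooth m i) x
  simpa [tildeD] using this

lemma tildeD_smul (m : ℕ) (c : ℝ) (φ : 𝓓(Ω, ℝ)) :
    tildeD m (c • φ : 𝓓(Ω, ℝ)) = c • tildeD m φ := by
  funext x
  ext i
  have := congrFun (tildeDComp_smul (isTest φ).smooth c m i) x
  simpa [tildeD] using this

/-- A test function as an element of `L²(Ω)`. -/
def testLp (φ : 𝓓(Ω, ℝ)) : L2 Ω := (isTest φ).memLp.toLp φ

/-- `D̃^m φ` as an element of `L²(Ω)`. -/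
def tildeLp (m : ℕ) (φ : 𝓓(Ω, ℝ)) : L2Tilde Ω := (memLp_tildeD m φ).toLp _

/-- The graph `φ ↦ (φ, D̃^m φ)` on test functions. -/
def graphMap (m : ℕ) (Ω : Opens (Space N)) : 𝓓(Ω, ℝ) →ₗ[ℝ] WithLp 2 (L2 Ω × L2Tilde Ω) where
  toFun φ := WithLp.toLp 2 (testLp φ, tildeLp m φ)
  map_add' φ χ := by
    have h1 : testLp (φ + χ) = testLp φ + testLp χ := rfl
    have h2 : tildeLp m (φ + χ) = tildeLp m φ + tildeLp m χ := by
      simp only [tildeLp, tildeD_add]; rfl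
    rw [h1, h2]; rfl
  map_smul' c φ := by
    have h1 : testLp (c • φ) = c • testLp φ := rfl
    have h2 : tildeLp m (c • φ) = c • tildeLp m φ := by
      simp only [tildeLp, tildeD_smul]; rfl
    rw [h1, h2]; rfl

/-- The closure of the graph of `D̃^m` on test functions. -/
abbrev GraphSpace (m : ℕ) (Ω : Opens (Space N)) : Submodule ℝ (WithLp 2 (L2 Ω × L2Tilde Ω)) :=
  (LinearMap.range (graphMap m Ω)).topologicalClosure

/-- The inclusion of the graph space in `L²(Ω)`. -/
def graphFst (m : ℕ) (Ω : Opens (Space N)) : GraphSpace m Ω →L[ℝ] L2 Ω :=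
  (WithLp.fstL 2 ℝ _ _).comp (GraphSpace m Ω).subtypeL

/-- The weak derivative `D̃^m` on the graph space. -/
def graphSnd (m : ℕ) (Ω : Opens (Space N)) : GraphSpace m Ω →L[ℝ] L2Tilde Ω :=
  (WithLp.sndL 2 ℝ _ _).comp (GraphSpace m Ω).subtypeL

lemma graph_norm_sq (m : ℕ) (z : GraphSpace m Ω) :
    ‖z‖ ^ 2 = ‖graphFst m Ω z‖ ^ 2 + ‖graphSnd m Ω z‖ ^ 2 :=
  WithLp.prod_norm_sq_eq_of_L2 (z : WithLp 2 (L2 Ω × L2Tilde Ω))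

/-- The graph element of a test function. -/
def graphTest (m : ℕ) (φ : 𝓓(Ω, ℝ)) : GraphSpace m Ω :=
  ⟨graphMap m Ω φ, Submodule.le_topologicalClosure _ ⟨φ, rfl⟩⟩

lemma graphFst_test (m : ℕ) (φ : 𝓓(Ω, ℝ)) : graphFst m Ω (graphTest m φ) = testLp φ := rfl

lemma graphSnd_test (m : ℕ) (φ : 𝓓(Ω, ℝ)) : graphSnd m Ω (graphTest m φ) = tildeLp m φ := rfl

lemma dense_range_graphTest (m : ℕ) : DenseRange (graphTest m (Ω := Ω)) := by
  intro z
  rw [closure_subtype]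
  have : ((↑) '' range (graphTest m (Ω := Ω)) : Set (WithLp 2 (L2 Ω × L2Tilde Ω))) =
      LinearMap.range (graphMap m Ω) := by
    rw [← range_comp]; rfl
  rw [this]
  exact z.2

/-- Pairing with a test function, as an inner product. -/
lemma integral_mul_eq_inner {f : Space N → ℝ} (hf : IsTest Ω f) (u : L2 Ω) :
    ∫ x in (Ω : Set (Space N)), u x * f x = inner ℝ u (hf.memLp.toLp f) := by
  rw [inner_Lp_eq]
  refine integral_congr_ae ?_
  filter_upwards [hf.memLp.coeFn_toLp] with x hx
  rw [hx]

lemma memLp_single {f : Space N → ℝ} (hf : IsTest Ω f) (i : Option (Fin N)) :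
    MemLp (fun x => (EuclideanSpace.single i (f x) : TildeSpace N)) 2
      (volume.restrict (Ω : Set (Space N))) := by
  refine hf.memLp.of_le (Continuous.aestronglyMeasurable ?_) (Eventually.of_forall fun x => ?_)
  · exact (PiLp.continuous_toLp 2 _).comp
      ((continuous_single i).comp hf.continuous)
  · simp

/-- Pairing of a component with a test function, as an inner product. -/
lemma integral_comp_mul_eq_inner {f : Space N → ℝ} (hf : IsTest Ω f) (g : L2Tilde Ω)
    (i : Option (Fin N)) :
    ∫ x in (Ω : Set (Space N)), g x i * f x = inner ℝ g ((memLp_single hf i).toLp _) := by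
  rw [L2.inner_def]
  refine integral_congr_ae ?_
  filter_upwards [(memLp_single hf i).coeFn_toLp] with x hx
  rw [hx, EuclideanSpace.inner_single_right]
  simp [mul_comm]

lemma hasWeakTildeD_test (m : ℕ) (φ : 𝓓(Ω, ℝ)) : HasWeakTildeD m (testLp φ) (tildeLp m φ) := by
  intro χ i
  have h1 : ∫ x in (Ω : Set (Space N)), testLp φ x * tildeDComp m χ i x =
      ∫ x in (Ω : Set (Space N)), φ x * tildeDComp m χ i x := by
    refine integral_congr_ae ?_
    filter_upwards [(isTest φ).memLp.coeFn_toLp] with x hx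
    rw [testLp, hx]
  have h2 : ∫ x in (Ω : Set (Space N)), tildeLp m φ x i * χ x =
      ∫ x in (Ω : Set (Space N)), tildeDComp m φ i x * χ x := by
    refine integral_congr_ae ?_
    filter_upwards [(memLp_tildeD m φ).coeFn_toLp] with x hx
    rw [tildeLp, hx, tildeD]
  rw [h1, h2, ((isTest χ).tilde m i).setIntegral_mul, (isTest χ).setIntegral_mul,
    (isTest φ).integral_mul_tildeDComp (isTest χ)]

lemma hasWeakTildeD_graph (m : ℕ) (z : GraphSpace m Ω) :
    HasWeakTildeD m (graphFst m Ω z) (graphSnd m Ω z) := by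
  intro φ i
  simp only [integral_mul_eq_inner ((isTest φ).tilde m i), integral_comp_mul_eq_inner (isTest φ)]
  refine (dense_range_graphTest m).induction_on z ?_ fun χ => ?_
  · exact isClosed_eq (by fun_prop) (by fun_prop)
  · have := hasWeakTildeD_test m χ φ i
    rwa [integral_mul_eq_inner ((isTest φ).tilde m i), integral_comp_mul_eq_inner (isTest φ)] at this

/-- The fundamental lemma of the calculus of variations in each component. It makes the choice in
`weakTildeD` immaterial. -/
lemma HasWeakTildeD.unique {m : ℕ} {u : L2 Ω} {g g' : L2Tilde Ω} (h : HasWeakTildeD m u g)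
    (h' : HasWeakTildeD m u g') : g = g' := by
  have hae : ∀ i, ∀ᵐ x ∂(volume.restrict (Ω : Set (Space N))), g x i - g' x i = 0 := by
    intro i
    have hc : ∀ g : L2Tilde Ω, MemLp (fun x => g x i) 2 (volume.restrict (Ω : Set (Space N))) :=
      fun g => (Lp.memLp g).of_le
        ((PiLp.continuous_apply 2 _ i).comp_aestronglyMeasurable (Lp.aestronglyMeasurable g))
        (Eventually.of_forall fun x => PiLp.norm_apply_le _ i)
    have hl : LocallyIntegrableOn (fun x => g x i - g' x i) (Ω : Set (Space N)) volume :=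
      locallyIntegrableOn_of_locallyIntegrable_restrict
        (((hc g).sub (hc g')).locallyIntegrable one_le_two)
    rw [ae_restrict_iff' Ω.isOpen.measurableSet]
    refine Ω.isOpen.ae_eq_zero_of_integral_contDiff_smul_eq_zero hl fun f hf hfc hfs => ?_
    let φ : 𝓓(Ω, ℝ) := ⟨f, hf, hfc, hfs⟩
    have h1 := (h φ i).symm.trans (h' φ i)
    have h2 := mul_left_cancel₀ (pow_ne_zero m (by norm_num : (-1 : ℝ) ≠ 0)) h1
    have h3 : ∫ x, f x • (g x i - g' x i) =
        ∫ x in (Ω : Set (Space N)), (g x i * f x - g' x i * f x) := by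
      rw [setIntegral_eq_integral_of_forall_compl_eq_zero fun x hx => by
        rw [(isTest φ).eq_zero_of_notMem hx |> fun h : f x = 0 => h, mul_zero, mul_zero, sub_zero]]
      refine integral_congr_ae (Eventually.of_forall fun x => ?_)
      simp only [smul_eq_mul]; ring
    have hi : ∀ g : L2Tilde Ω, Integrable (fun x => g x i * f x)
        (volume.restrict (Ω : Set (Space N))) := fun g => (hc g).integrable_mul (isTest φ).memLp
    rw [h3, integral_sub (hi g) (hi g')]
    exact sub_eq_zero.2 h2
  refine Lp.ext ?_
  filter_upwards [ae_all_iff.2 hae] with x hx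
  ext i
  exact sub_eq_zero.1 (hx i)

lemma weakTildeD_eq {m : ℕ} {u : L2 Ω} {g : L2Tilde Ω} (h : HasWeakTildeD m u g) :
    weakTildeD m u = g := by
  have hex : ∃ g : L2Tilde Ω, HasWeakTildeD m u g := ⟨g, h⟩
  rw [weakTildeD, dif_pos hex]
  exact hex.choose_spec.unique h

lemma weakTildeD_graph (m : ℕ) (z : GraphSpace m Ω) :
    weakTildeD m (graphFst m Ω z) = graphSnd m Ω z :=
  weakTildeD_eq (hasWeakTildeD_graph m z)

/-- This is closability of `D̃^m`: the second coordinate is the weak derivative of the first. -/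
lemma graphFst_injective (m : ℕ) (Ω : Opens (Space N)) : Function.Injective (graphFst m Ω) := by
  intro z z' h
  have h2 : graphSnd m Ω z = graphSnd m Ω z' := by
    rw [← weakTildeD_graph, ← weakTildeD_graph, h]
  have h3 := graph_norm_sq m (z - z')
  rw [map_sub, map_sub, h, h2, sub_self, sub_self] at h3
  simpa [sub_eq_zero] using h3

/-- Along the approximating test functions, `D̃^m φ k` is Cauchy because its differences are
dominated by those of the full derivative of order `m`; the limit pair lies in the closed graph. -/
lemma exists_graph_of_memH0 {m : ℕ} {u : L2 Ω} (hu : MemH0 m u) :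
    ∃ z : GraphSpace m Ω, graphFst m Ω z = u := by
  obtain ⟨φ, h1, h2⟩ := hu
  obtain ⟨G, hG, h3⟩ := h2 m le_rfl
  have hu1 : Tendsto (fun k => testLp (φ k)) atTop (𝓝 u) := by
    have := (Lp.tendsto_Lp_iff_tendsto_eLpNorm'' (fun k => (φ k : Space N → ℝ))
      (fun k => (isTest (φ k)).memLp) u (Lp.memLp u)).2 h1
    rwa [Lp.toLp_coeFn] at this
  have hG1 := (Lp.tendsto_Lp_iff_tendsto_eLpNorm'' (fun k => iteratedFDeriv ℝ m (φ k))
      (fun k => memLp_iteratedFDeriv m (φ k)) G hG).2 h3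
  set A := fun k => (memLp_iteratedFDeriv m (φ k)).toLp (iteratedFDeriv ℝ m (φ k)) with hA
  set c : ℝ := (N + 1) * N ^ (m / 2) with hc
  have hc0 : 0 ≤ c := by positivity
  have hdist : ∀ k l, dist (tildeLp m (φ k)) (tildeLp m (φ l)) ≤ c * dist (A k) (A l) := by
    intro k l
    rw [dist_eq_norm, dist_eq_norm]
    refine Lp.norm_le_mul_norm_of_ae_le_mul ?_
    filter_upwards [Lp.coeFn_sub (tildeLp m (φ k)) (tildeLp m (φ l)), Lp.coeFn_sub (A k) (A l),
      (memLp_tildeD m (φ k)).coeFn_toLp, (memLp_tildeD m (φ l)).coeFn_toLp,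
      (memLp_iteratedFDeriv m (φ k)).coeFn_toLp, (memLp_iteratedFDeriv m (φ l)).coeFn_toLp]
      with x e1 e2 e3 e4 e5 e6
    rw [e1, e2, Pi.sub_apply, Pi.sub_apply, tildeLp, tildeLp, e3, e4, e5, e6]
    have e7 : tildeD m (φ k) x - tildeD m (φ l) x = tildeD m (φ k - φ l : 𝓓(Ω, ℝ)) x := by
      have : φ k = (φ k - φ l) + φ l := by abel
      conv_lhs => rw [this, tildeD_add]
      simp
    have e8 : iteratedFDeriv ℝ m (φ k) x - iteratedFDeriv ℝ m (φ l) x =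
        iteratedFDeriv ℝ m (φ k - φ l : 𝓓(Ω, ℝ)) x := by
      have := iteratedFDeriv_sub_apply (𝕜 := ℝ) (i := m) (x := x) (f := φ k) (g := φ l)
        ((φ k).contDiff.contDiffAt.of_le (WithTop.coe_le_coe.2 le_top))
        ((φ l).contDiff.contDiffAt.of_le (WithTop.coe_le_coe.2 le_top))
      exact this.symm
    rw [e7, e8]
    exact norm_tildeD_le (isTest _).smooth m x
  have hcauchy : CauchySeq fun k => tildeLp m (φ k) := by
    rw [Metric.cauchySeq_iff]
    intro ε hε
    obtain ⟨K, hK⟩ := Metric.cauchySeq_iff.1 hG1.cauchySeq (ε / (c + 1)) (by positivity)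
    refine ⟨K, fun k hk l hl => (hdist k l).trans_lt ?_⟩
    have := hK k hk l hl
    rw [lt_div_iff₀ (by positivity)] at this
    have h0 := dist_nonneg (x := A k) (y := A l)
    simp only [hA] at h0 ⊢
    nlinarith
  obtain ⟨g, hg⟩ := cauchySeq_tendsto_of_complete hcauchy
  have hlim : Tendsto (fun k => graphMap m Ω (φ k)) atTop (𝓝 (WithLp.toLp 2 (u, g))) :=
    ((WithLp.prodContinuousLinearEquiv 2 ℝ (L2 Ω) (L2Tilde Ω)).symm.continuous.tendsto
      (u, g)).comp (hu1.prodMk_nhds hg)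
  exact ⟨⟨_, mem_closure_of_tendsto hlim (Eventually.of_forall fun k => ⟨φ k, rfl⟩)⟩, rfl⟩

instance (m : ℕ) (Ω : Opens (Space N)) : SecondCountableTopology (GraphSpace m Ω) := by
  have : Fact ((2 : ℝ≥0∞) ≠ ∞) := ⟨ENNReal.ofNat_ne_top⟩
  have : SecondCountableTopology (L2 Ω) := inferInstance
  have : SecondCountableTopology (L2Tilde Ω) := inferInstance
  have : SecondCountableTopology (WithLp 2 (L2 Ω × L2Tilde Ω)) :=
    (WithLp.prodContinuousLinearEquiv 2 ℝ (L2 Ω) (L2Tilde Ω)).toHomeomorph.secondCountableTopology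
  infer_instance

instance (m : ℕ) (Ω : Opens (Space N)) : CompleteSpace (GraphSpace m Ω) := by infer_instance

instance (m : ℕ) (Ω : Opens (Space N)) : PolishSpace (GraphSpace m Ω) := by infer_instance

end GraphSpace

/-! ### Weak solutions as abstract gradient flows -/

section WeakSolution

variable {N m : ℕ} {n : ℝ} {Ω : Opens (Space N)}

lemma isFiniteMeasure_restrict_of_isBounded (hΩ : Bornology.IsBounded (Ω : Set (Space N))) :
    IsFiniteMeasure (volume.restrict (Ω : Set (Space N))) :=
  ⟨by simpa using hΩ.measure_lt_top⟩

lemma dirichletInt_graph (z : GraphSpace m Ω) :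
    dirichletInt m (graphFst m Ω z) = ‖graphSnd m Ω z‖ ^ 2 := by
  rw [dirichletInt, weakTildeD_graph, ← real_inner_self_eq_norm_sq, L2.inner_def]
  simp only [real_inner_self_eq_norm_sq]

lemma energy_graph (z : GraphSpace m Ω) :
    energy m (graphFst m Ω z) = energyForm (graphFst m Ω) (graphSnd m Ω) z z := by
  rw [energy, dirichletInt_graph, energyForm_apply, real_inner_self_eq_norm_sq (graphSnd m Ω z),
    inner_Lp_eq]
  simp only [sq]
  ring

lemma PhiFun_eq (hn : 0 < n) (u : L2 Ω) : PhiFun n u = (n + 2) / 2 * powInt n u := by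
  rw [PhiFun, powInt, ← mul_assoc]
  congr 1
  field_simp

lemma integral_psi_mul (hn : 0 < n) [IsFiniteMeasure (volume.restrict (Ω : Set (Space N)))]
    (u : L2 Ω) (φ : 𝓓(Ω, ℝ)) :
    ∫ x in (Ω : Set (Space N)), psi n (u x) * φ x = inner ℝ (psiLp hn u) (testLp φ) := by
  rw [testLp, ← integral_mul_eq_inner (isTest φ)]
  refine integral_congr_ae ?_
  filter_upwards [psiLp_ae hn u] with x hx
  rw [hx]

/-- The integrand of the weak formulation, on the graph space. -/
lemma weakForm_integrand (z : GraphSpace m Ω) (φ : 𝓓(Ω, ℝ)) :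
    -(∫ x in (Ω : Set (Space N)),
        inner ℝ (weakTildeD m (graphFst m Ω z) x) (tildeD m φ x)) +
      ∫ x in (Ω : Set (Space N)), graphFst m Ω z x * φ x =
    energyForm (graphFst m Ω) (graphSnd m Ω) z (graphTest m φ) := by
  have h1 : ∫ x in (Ω : Set (Space N)),
      inner ℝ (weakTildeD m (graphFst m Ω z) x) (tildeD m φ x) =
      inner ℝ (graphSnd m Ω z) (tildeLp m φ) := by
    rw [weakTildeD_graph, L2.inner_def]
    refine integral_congr_ae ?_
    filter_upwards [(memLp_tildeD m φ).coeFn_toLp] with x hx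
    rw [tildeLp, hx]
  rw [h1, integral_mul_eq_inner (isTest φ), energyForm_apply, graphFst_test, graphSnd_test, testLp]
  ring

/-- A measurable left inverse of the inclusion of the graph space, composed with a continuous
curve. -/
lemma exists_stronglyMeasurable_lift {v : ℝ → L2 Ω} (hv : Continuous v) :
    ∃ g : ℝ → GraphSpace m Ω, StronglyMeasurable g ∧
      ∀ t z, v t = graphFst m Ω z → g t = z := by
  let : MeasurableSpace (L2 Ω) := borel _
  have : BorelSpace (L2 Ω) := ⟨rfl⟩
  let : MeasurableSpace (GraphSpace m Ω) := borel _
  have : BorelSpace (GraphSpace m Ω) := ⟨rfl⟩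
  -- Lusin–Souslin: a continuous injection of a Polish space is a measurable embedding. Its
  -- measurable left inverse lifts the curve.
  have hemb : MeasurableEmbedding (graphFst m Ω) :=
    (graphFst m Ω).continuous.measurableEmbedding (graphFst_injective m Ω)
  obtain ⟨L, hL, hLe⟩ := hemb.exists_measurable_extend measurable_id fun _ => ⟨0⟩
  refine ⟨fun t => L (v t), (hL.comp hv.measurable).stronglyMeasurable, fun t z h => ?_⟩
  change L (v t) = z
  rw [h]
  exact congrFun hLe z

/-- A weak solution is an abstract gradient flow on every compact time interval. -/
lemma IsWeakSolution.exists_isGradientFlow (hn : 0 < n)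
    [IsFiniteMeasure (volume.restrict (Ω : Set (Space N)))] {S : EReal} {v₀ : L2 Ω} {v : ℝ → L2 Ω}
    (hv : IsWeakSolution m n S v₀ v) {z₀ : GraphSpace m Ω} (hz₀ : graphFst m Ω z₀ = v₀) {τ : ℝ}
    (hτ : 0 < τ) (hτS : (τ : EReal) < S) :
    ∃ g : ℝ → GraphSpace m Ω, ∃ C : ℝ, IsGradientFlow (graphFst m Ω) (graphSnd m Ω) (psiLp hn)
      (powInt n) ((n + 2) / (n + 1)) C τ z₀ g (fun t => v (max 0 (min τ t))) := by
  -- Freezing `v` outside `[0, τ]` makes the curve continuous on all of `ℝ`.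
  set w : ℝ → L2 Ω := fun t => v (max 0 (min τ t)) with hw
  have hlt : ∀ t : ℝ, t ≤ τ → (t : EReal) < S := fun t ht =>
    (EReal.coe_le_coe_iff.2 ht).trans_lt hτS
  have hwc : Continuous w := hv.continuousOn.comp_continuous (by fun_prop) fun t =>
    ⟨le_max_left _ _, hlt _ (max_le hτ.le (min_le_left _ _))⟩
  have hweq : ∀ t ∈ Icc 0 τ, w t = v t := fun t ht => by
    simp only [hw, min_eq_right ht.2, max_eq_right ht.1]
  obtain ⟨L, hL, hLz⟩ := exists_stronglyMeasurable_lift (m := m) hwc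
  have hlift : ∀ᵐ t, t ∈ Ioo 0 τ → v t = graphFst m Ω (L t) := by
    filter_upwards [hv.memH0] with t ht hm
    obtain ⟨z, hz⟩ := exists_graph_of_memH0 (ht hm.1 (hlt t hm.2.le))
    rw [hLz t z (by rw [hweq t (Ioo_subset_Icc_self hm), hz]), hz]
  set g : ℝ → GraphSpace m Ω := (Ioo 0 τ).indicator L with hg
  have hgL : ∀ t ∈ Ioo 0 τ, g t = L t := fun t ht => indicator_of_mem ht L
  have hgint : Integrable g := by
    suffices h : IntegrableOn L (Ioo 0 τ) from h.integrable_indicator measurableSet_Ioo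
    have h1 : IntegrableOn (fun t => 1 + (‖w t‖ ^ 2 + dirichletInt m (v t))) (Ioo 0 τ) :=
      (integrableOn_const (by simp)).add
        (((hwc.norm.pow 2).continuousOn.integrableOn_Icc.mono_set Ioo_subset_Icc_self).add
          (hv.sqIntegrable τ hτ hτS))
    refine Integrable.mono' h1 hL.aestronglyMeasurable ?_
    rw [ae_restrict_iff' measurableSet_Ioo]
    filter_upwards [hlift] with t ht hm
    have h2 := graph_norm_sq m (L t)
    rw [← dirichletInt_graph, ← ht hm, ← hweq t (Ioo_subset_Icc_self hm)] at h2
    rw [← hweq t (Ioo_subset_Icc_self hm), ← h2]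
    -- On a bounded interval square integrability suffices, through `‖L‖ ≤ 1 + ‖L‖²`.
    nlinarith [sq_nonneg (‖L t‖ - 1)]
  have hτne : ∀ᵐ x : ℝ, x ≠ τ := by simp [ae_iff, measure_singleton]
  have hev0 : ∀ t ∈ Icc 0 τ, ∀ φ : 𝓓(Ω, ℝ),
      inner ℝ (psiLp hn (w t) - psiLp hn v₀) (testLp φ) =
      energyForm (graphFst m Ω) (graphSnd m Ω) (∫ r in (0 : ℝ)..t, g r) (graphTest m φ) := by
    intro t ht φ
    have h1 := hv.weakForm φ t ht.1 (hlt t ht.2)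
    rw [integral_psi_mul hn, integral_psi_mul hn, ← inner_sub_left, ← hweq t ht] at h1
    rw [h1]
    have h2 := ContinuousLinearMap.intervalIntegral_comp_comm
      ((energyForm (graphFst m Ω) (graphSnd m Ω)).flip (graphTest m φ))
      (hgint.intervalIntegrable (a := 0) (b := t))
    simp only [ContinuousLinearMap.flip_apply] at h2
    rw [← h2]
    refine intervalIntegral.integral_congr_ae ?_
    filter_upwards [hlift, hτne] with s hs hsτ hm
    rw [uIoc_of_le ht.1] at hm
    have hs' : s ∈ Ioo 0 τ := ⟨hm.1, lt_of_le_of_ne (hm.2.trans ht.2) hsτ⟩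
    rw [hs hs', weakForm_integrand, hgL s hs']
  have hev : ∀ s ∈ Icc 0 τ, ∀ t ∈ Icc 0 τ, ∀ z : GraphSpace m Ω,
      inner ℝ (psiLp hn (w t) - psiLp hn (w s)) (graphFst m Ω z) =
      energyForm (graphFst m Ω) (graphSnd m Ω) (∫ r in s..t, g r) z := by
    intro s hs t ht z
    refine (dense_range_graphTest m).induction_on z (isClosed_eq (by fun_prop) (by fun_prop))
      fun φ => ?_
    rw [← intervalIntegral.integral_interval_sub_left
      (hgint.intervalIntegrable (a := 0) (b := t)) (hgint.intervalIntegrable (a := 0) (b := s)),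
      map_sub, _root_.sub_apply, ← hev0 t ht, ← hev0 s hs, graphFst_test, ← inner_sub_left]
    congr 1
    abel
  refine ⟨g, 4 * (‖Lp.const 2 (volume.restrict (Ω : Set (Space N))) (1 : ℝ)‖ + 1), ?_⟩
  exact
    { injective := graphFst_injective m Ω
      norm_sq := graph_norm_sq m
      p_pos := by positivity
      C_nonneg := by positivity
      continuous_F := continuous_powInt hn
      convex := psiLp_convex hn
      coercive := psiLp_coercive hn
      tau_pos := hτ
      integrable := hgint
      continuous_v := hwc
      ae_eq := by
        filter_upwards [hlift] with t ht hm
        rw [hgL t hm, ← ht hm]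
        exact hweq t (Ioo_subset_Icc_self hm)
      initial := by
        rw [hz₀, ← hv.initial]
        exact hweq 0 ⟨le_rfl, hτ.le⟩
      evolution := hev }

/-- From the decay of a negative power to the blow-up rate. -/
lemma blowup_bound {γ f f₀ x : ℝ} (hγ : 0 < γ) (hf : 0 < f) (hf₀ : 0 < f₀)
    (h : f ^ (-γ) ≤ f₀ ^ (-γ) * x) : 0 < x ∧ f₀ * (1 / x ^ (1 / γ)) ≤ f := by
  have h1 : 0 < f ^ (-γ) := Real.rpow_pos_of_pos hf _
  have h2 : 0 < f₀ ^ (-γ) := Real.rpow_pos_of_pos hf₀ _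
  have hx : 0 < x := by
    by_contra hcon
    push Not at hcon
    nlinarith
  refine ⟨hx, ?_⟩
  have h3 := Real.rpow_le_rpow_of_nonpos h1 h (show -(1 / γ) ≤ 0 by
    have : 0 < 1 / γ := by positivity
    linarith)
  rw [Real.mul_rpow h2.le hx.le, ← Real.rpow_mul hf.le, ← Real.rpow_mul hf₀.le] at h3
  have h4 : -γ * -(1 / γ) = 1 := by field_simp
  rw [h4, Real.rpow_one, Real.rpow_one, Real.rpow_neg hx.le] at h3
  rwa [one_div]

lemma tendsto_blowup_rate {c T a : ℝ} (hc : 0 < c) (hT : 0 < T) (ha : 0 < a) :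
    Tendsto (fun t => c * (1 / (1 - t / T) ^ a)) (𝓝[<] T) atTop := by
  have h1 : Tendsto (fun t : ℝ => 1 - t / T) (𝓝[<] T) (𝓝[>] 0) := by
    refine tendsto_nhdsWithin_iff.2 ⟨?_, ?_⟩
    · have hcont : Continuous fun t : ℝ => 1 - t / T := by fun_prop
      have := (hcont.tendsto T).mono_left (nhdsWithin_le_nhds (s := Iio T))
      simpa [div_self hT.ne'] using this
    · filter_upwards [self_mem_nhdsWithin] with t ht
      have : t / T < 1 := (div_lt_one hT).2 ht
      simpa using this
  have h2 : Tendsto (fun x : ℝ => x ^ a) (𝓝[>] 0) (𝓝[>] 0) := by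
    refine tendsto_nhdsWithin_iff.2 ⟨?_, ?_⟩
    · have := (Real.continuousAt_rpow_const 0 a (Or.inr ha.le)).tendsto
      rw [Real.zero_rpow ha.ne'] at this
      exact this.mono_left nhdsWithin_le_nhds
    · filter_upwards [self_mem_nhdsWithin] with x hx
      exact Real.rpow_pos_of_pos hx _
  have h3 := tendsto_inv_nhdsGT_zero.comp (h2.comp h1)
  simp only [one_div]
  exact h3.const_mul_atTop hc

end WeakSolution

end PolyharmonicBlowUp

end

/-! ### The blow-up theorem -/

open PolyharmonicBlowUp in
theorem theorem5p2 (N : ℕ) (hN : 1 ≤ N) (m : ℕ) (hm : 2 ≤ m) (n : ℝ) (hn : 0 < n)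
    (Ω : TopologicalSpace.Opens (PolyharmonicBlowUp.Space N))
    (hΩ : Bornology.IsBounded (Ω : Set (PolyharmonicBlowUp.Space N)))
    (v₀ : PolyharmonicBlowUp.L2 Ω) (hv₀ : PolyharmonicBlowUp.MemH0 m v₀)
    (hΦ : 0 < PolyharmonicBlowUp.PhiFun n v₀) (hE : 0 < PolyharmonicBlowUp.energy m v₀)
    (S : EReal) (hS : 0 < S) (v : ℝ → PolyharmonicBlowUp.L2 Ω)
    (hv : PolyharmonicBlowUp.IsWeakSolution m n S v₀ v)
    (T : ℝ)
    (hT : T = 2 / n * (PolyharmonicBlowUp.PhiFun n v₀ / PolyharmonicBlowUp.energy m v₀)) :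
    (∃ Φ' : ℝ,
      HasDerivWithinAt (fun t => PolyharmonicBlowUp.PhiFun n (v t)) Φ' (Set.Ici 0) 0 ∧
      0 < Φ' ∧ T = (n + 2) / n * (PolyharmonicBlowUp.PhiFun n v₀ / Φ')) ∧
    0 < T ∧ S ≤ (T : EReal) ∧
    (∀ t : ℝ, 0 ≤ t → (t : EReal) < S →
      PolyharmonicBlowUp.PhiFun n v₀ * (1 / (1 - t / T) ^ ((n + 2) / n)) ≤
        PolyharmonicBlowUp.PhiFun n (v t)) ∧
    (S = (T : EReal) →
      Tendsto (fun t => PolyharmonicBlowUp.PhiFun n (v t)) (𝓝[<] T) atTop) := by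
  have := isFiniteMeasure_restrict_of_isBounded hΩ
  obtain ⟨z₀, hz₀⟩ := exists_graph_of_memH0 hv₀
  have hE₀ : energyForm (graphFst m Ω) (graphSnd m Ω) z₀ z₀ = energy m v₀ := by
    rw [← energy_graph, hz₀]
  have hTpos : 0 < T := by rw [hT]; positivity
  have hf₀ : 0 < powInt n v₀ := by
    rw [PhiFun_eq hn] at hΦ
    exact (mul_pos_iff_of_pos_left (by positivity)).1 hΦ
  -- The exponent is `q = 2/p`; then `q - 1 = n/(n+2)`, whose inverse is the blow-up exponent.
  have hq : 2 * (n + 1) / (n + 2) = 2 / ((n + 2) / (n + 1)) := by field_simp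
  have hq1 : 1 < 2 * (n + 1) / (n + 2) := by
    rw [lt_div_iff₀ (by positivity)]; linarith
  have hTf : T = (n + 2) / n * (powInt n v₀ / energy m v₀) := by
    rw [hT, PhiFun_eq hn]; field_simp
  have key : ∀ t : ℝ, 0 ≤ t → (t : EReal) < S →
      0 < 1 - t / T ∧ powInt n v₀ * (1 / (1 - t / T) ^ ((n + 2) / n)) ≤ powInt n (v t) := by
    intro t ht htS
    obtain ⟨τ, htτ, hτS⟩ := EReal.lt_iff_exists_real_btwn.1 htS
    have htτ' : t < τ := EReal.coe_lt_coe_iff.1 htτ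
    have hτ : 0 < τ := ht.trans_lt htτ'
    obtain ⟨g, C, h⟩ := hv.exists_isGradientFlow hn hz₀ hτ hτS
    have hv0 : v (max 0 (min τ 0)) = v₀ := by
      rw [min_eq_right hτ.le, max_self, hv.initial]
    have hvt : v (max 0 (min τ t)) = v t := by rw [min_eq_right htτ'.le, max_eq_right ht]
    have h1 := h.rpow_F_le (by rwa [hE₀]) (by rwa [hv0]) hq hq1 ⟨ht, htτ'⟩
    have h2 := h.F_ge (by rwa [hE₀]) ⟨ht, htτ'.le⟩
    simp only [hv0, hvt, hE₀] at h1 h2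
    have e1 : 1 - 2 * (n + 1) / (n + 2) = -(n / (n + 2)) := by field_simp; ring
    have e2 : 2 * (n + 1) / (n + 2) - 1 = n / (n + 2) := by field_simp; ring
    have e3 : -(2 * (n + 1) / (n + 2)) = -(n / (n + 2)) + -1 := by field_simp; ring
    rw [e1, e2, e3, Real.rpow_add hf₀, Real.rpow_neg_one] at h1
    have h3 := blowup_bound (γ := n / (n + 2)) (x := 1 - t / T) (by positivity)
      (hf₀.trans_le h2) hf₀ (h1.trans (le_of_eq (by rw [hTf]; field_simp)))
    rwa [one_div_div] at h3
  have main : ∀ t : ℝ, 0 ≤ t → (t : EReal) < S →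
      PhiFun n v₀ * (1 / (1 - t / T) ^ ((n + 2) / n)) ≤ PhiFun n (v t) := by
    intro t ht htS
    rw [PhiFun_eq hn, PhiFun_eq hn, mul_assoc]
    exact mul_le_mul_of_nonneg_left (key t ht htS).2 (by positivity)
  -- `F` has right derivative `E(0)` at time `0`, and `Φ = (n+2)/2 · F`.
  refine ⟨⟨(n + 2) / 2 * energy m v₀, ?_, by positivity, ?_⟩, hTpos, ?_, main, ?_⟩
  · obtain ⟨τ, hτ, hτS⟩ := EReal.lt_iff_exists_real_btwn.1 hS
    have hτ' : 0 < τ := EReal.coe_pos.1 hτ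
    obtain ⟨g, C, h⟩ := hv.exists_isGradientFlow hn hz₀ hτ' hτS
    have h1 := (h.hasDerivWithinAt_F_zero.const_mul ((n + 2) / 2))
    rw [hE₀] at h1
    refine h1.congr_of_eventuallyEq_of_mem ?_ self_mem_Ici
    filter_upwards [Icc_mem_nhdsGE hτ'] with t ht
    rw [PhiFun_eq hn, min_eq_right ht.2, max_eq_right ht.1]
  · rw [hT]; field_simp
  -- If the solution lived at time `T`, positivity of `1 - t/T` at `t = T` would fail.
  · by_contra hcon
    push Not at hcon
    have := (key T hTpos.le hcon).1
    rw [div_self hTpos.ne'] at this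
    linarith
  · intro hST
    refine tendsto_atTop_mono' _ ?_ (tendsto_blowup_rate (a := (n + 2) / n) hΦ hTpos (by positivity))
    filter_upwards [Ioo_mem_nhdsLT hTpos] with t ht
    exact main t ht.1.le (by rw [hST]; exact EReal.coe_lt_coe_iff.2 ht.2)
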